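/- Throughout, a real rational knot of degree $d$ in $\mathbb{RP}^3$ is a curve $C$ admitting a parametrization $[s:t]\mapsto[k_0(s,t):k_1(s,t):k_2(s,t):k_3(s,t)]$, where $k_0,\dots,k_3$ are real homogeneous polynomials of degree $d$ without common root in $\mathbb{CP}^1$, such that the induced map $\mathbb{CP}^1\to\mathbb{CP}^3$ is injective with nowhere vanishing differential (so $C$ has no real or complex singular points). Two such knots of degree $d$ are rigidly isotopic if they can be joined by a path of real rational knots of degree $d$ in $\mathbb{RP}^3$, i.e. by a family of such parametrizations whose coefficients depend continuously on the time $\tau\in[0,1]$ and whose members at $\tau=0$ and $\tau=1$ parametrize the two knots. A hyperboloid in $\mathbb{RP}^3$ is a quadric that is given by $x_0x_3-x_1x_2=0$ in suitable real projective coordinates. Lemma. Every (non-singular) real rational knot of degree $4$ that lies on a hyperboloid in $\mathbb{RP}^3$ is rigidly isotopic in $\mathbb{RP}^3$ to one of the two curves $$K_1:\ [s(s^3+t^3):s(s^3-t^3):t(s^3+t^3):t(s^3-t^3)],$$ $$K_2:\ [s^2(s^2-4t^2):st(s^2-t^2):st(s^2-4t^2):t^2(s^2-t^2)],$$ or to the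 image of $K_1$ or of $K_2$ under the reflection $x_1\leftrightarrow x_2$ in the plane $x_1=x_2$. Moreover, $K_1$ and $K_2$ are themselves real rational knots of degree $4$ on the hyperboloid $x_0x_3=x_1x_2$. If this hyperboloid is identified with $\mathbb{RP}^1\times\mathbb{RP}^1$ by the Segre map $([x_0:x_1],[x_2:x_3])\mapsto[x_0x_2:x_0x_3:x_1x_2:x_1x_3]$ and every $\mathbb{RP}^1$ is oriented by $u\mapsto[\cos u:\sin u]$, then the real bi-degree (the pair of topological degrees of the two components $\mathbb{RP}^1\to\mathbb{RP}^1$ of the parametrization) is $(1,-1)$ for $K_1$ (that is, $(1,1)$ if the orientation of the second factor is reversed) and $(1,3)$ for $K_2$. -/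

import Mathlib

namespace RationalKnot

/-- Complex projective 3-space; real curves and real quadrics in `ℝℙ³` are given by their sets of
complex points. -/
abbrev CP3 : Type := Projectivization ℂ (Fin 4 → ℂ)

/-- Polynomials in two variables `s = X 0`, `t = X 1` with real coefficients. -/
abbrev Form : Type := MvPolynomial (Fin 2) ℝ

/-- The values `(k₀(v), …, k₃(v))` at a complex vector `v = (s, t)`. -/
noncomputable def value (k : Fin 4 → Form) (v : Fin 2 → ℂ) : Fin 4 → ℂ :=
  fun i => MvPolynomial.aeval v (k i)

/-- The partial derivatives of `(k₀, …, k₃)` with respect to the `j`-th variable at `v`. -/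
noncomputable def partialValue (k : Fin 4 → Form) (j : Fin 2) (v : Fin 2 → ℂ) : Fin 4 → ℂ :=
  fun i => MvPolynomial.aeval v (MvPolynomial.pderiv j (k i))

/-- The set of complex points of the curve `[s : t] ↦ [k₀ : k₁ : k₂ : k₃]`. -/
def complexPoints (k : Fin 4 → Form) : Set CP3 :=
  {P | ∃ v : Fin 2 → ℂ, v ≠ 0 ∧ ∃ h : value k v ≠ 0, Projectivization.mk ℂ (value k v) h = P}

/-- `k` parametrizes a real rational knot of degree `d` in `ℝℙ³`: the coordinates are real forms of
degree `d` without a common (real or complex) root, the induced map `ℂℙ¹ → ℂℙ³` has no double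
points, and its differential vanishes nowhere (in homogeneous coordinates: the two partial
derivatives are linearly independent at every point). -/
structure IsKnotParametrization (d : ℕ) (k : Fin 4 → Form) : Prop where
  homogeneous : ∀ i, (k i).IsHomogeneous d
  no_common_root : ∀ v : Fin 2 → ℂ, v ≠ 0 → value k v ≠ 0
  no_double_point : ∀ v w : Fin 2 → ℂ, v ≠ 0 → w ≠ 0 →
    (∃ c : ℂ, value k v = c • value k w) → ∃ c : ℂ, v = c • w
  immersion : ∀ v : Fin 2 → ℂ, v ≠ 0 →
    LinearIndependent ℂ ![partialValue k 0 v, partialValue k 1 v]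

/-- `C` is (the set of complex points of) a real rational knot of degree `d` in `ℝℙ³`. -/
def IsRealRationalKnot (d : ℕ) (C : Set CP3) : Prop :=
  ∃ k : Fin 4 → Form, IsKnotParametrization d k ∧ complexPoints k = C

/-- Rigid isotopy: a path of real rational knots of degree `d`, i.e. a family of parametrizations of
such knots, with coefficients depending continuously on the time, from `C` to `C'`. -/
def RigidlyIsotopic (d : ℕ) (C C' : Set CP3) : Prop :=
  ∃ γ : unitInterval → Fin 4 → Form,
    (∀ (i : Fin 4) (m : Fin 2 →₀ ℕ), Continuous fun τ => (γ τ i).coeff m) ∧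
    (∀ τ, IsKnotParametrization d (γ τ)) ∧
    complexPoints (γ 0) = C ∧ complexPoints (γ 1) = C'

/-- A real invertible matrix acts injectively on `ℂ⁴`. -/
theorem toLin_injective (A : GL (Fin 4) ℝ) :
    Function.Injective (Matrix.toLin' ((A : Matrix (Fin 4) (Fin 4) ℝ).map Complex.ofReal)) := by
  have h : ((A⁻¹ : GL (Fin 4) ℝ) : Matrix (Fin 4) (Fin 4) ℝ).map Complex.ofReal *
      (A : Matrix (Fin 4) (Fin 4) ℝ).map Complex.ofReal = 1 := by
    have h1 := Matrix.map_mul (L := ((A⁻¹ : GL (Fin 4) ℝ) : Matrix (Fin 4) (Fin 4) ℝ))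
      (M := (A : Matrix (Fin 4) (Fin 4) ℝ)) (f := Complex.ofRealHom)
    have h2 : ((A⁻¹ : GL (Fin 4) ℝ) : Matrix (Fin 4) (Fin 4) ℝ) *
        (A : Matrix (Fin 4) (Fin 4) ℝ) = 1 := by
      rw [← Units.val_mul, inv_mul_cancel, Units.val_one]
    rw [h2] at h1
    have h3 := Matrix.map_one (n := Fin 4) Complex.ofRealHom
      (map_zero Complex.ofRealHom) (map_one Complex.ofRealHom)
    rw [h3] at h1
    exact h1.symm
  refine Function.LeftInverse.injective (g := Matrix.toLin'
    (((A⁻¹ : GL (Fin 4) ℝ) : Matrix (Fin 4) (Fin 4) ℝ).map Complex.ofReal)) fun x => ?_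
  rw [← LinearMap.comp_apply, ← Matrix.toLin'_mul, h, Matrix.toLin'_one, LinearMap.id_apply]

/-- The real projective transformation given by `A`, on complex points. -/
noncomputable def projTransform (A : GL (Fin 4) ℝ) : CP3 → CP3 :=
  Projectivization.map (Matrix.toLin' ((A : Matrix (Fin 4) (Fin 4) ℝ).map Complex.ofReal))
    (toLin_injective A)

/-- The standard hyperboloid `z₀z₃ - z₁z₂ = 0` (its complex points). -/
def stdHyperboloid : Set CP3 :=
  {P | P.rep 0 * P.rep 3 - P.rep 1 * P.rep 2 = 0}

/-- A hyperboloid in `ℝℙ³`: a quadric which is `z₀z₃ - z₁z₂ = 0` in suitable real projective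
coordinates (equivalently, the quadric of a real quadratic form of signature `(2, 2)`). -/
def IsHyperboloid (X : Set CP3) : Prop :=
  ∃ A : GL (Fin 4) ℝ, X = projTransform A '' stdHyperboloid

/-- The matrix of the reflection in the plane `x₁ = x₂`. -/
noncomputable def reflectionMatrix : GL (Fin 4) ℝ :=
  Matrix.GeneralLinearGroup.mkOfDetNeZero
    !![1, 0, 0, 0; 0, 0, 1, 0; 0, 1, 0, 0; 0, 0, 0, 1]
    (by simp [Matrix.det_succ_row_zero, Fin.sum_univ_succ, Fin.succAbove])

/-- The image of a curve under the reflection of `ℝℙ³` in the plane `x₁ = x₂`. -/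
noncomputable def reflected (C : Set CP3) : Set CP3 := projTransform reflectionMatrix '' C

/-- `[s : t] ↦ [q₀(s,t) : q₁(s,t)]` is a map `ℝℙ¹ → ℝℙ¹` of degree `n`, for the orientation of `ℝℙ¹`
given by `u ↦ [cos u : sin u]`: it has a continuous lift `φ` to the universal cover
`ℝ → ℝℙ¹, u ↦ [cos u : sin u]`, and `φ (u + π) = φ u + n π`. -/
def HasRealDegree (q : Fin 2 → Form) (n : ℤ) : Prop :=
  ∃ φ : ℝ → ℝ, Continuous φ ∧
    (∀ u : ℝ, ∃ ρ : ℝ, ρ ≠ 0 ∧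
      MvPolynomial.eval ![Real.cos u, Real.sin u] (q 0) = ρ * Real.cos (φ u) ∧
      MvPolynomial.eval ![Real.cos u, Real.sin u] (q 1) = ρ * Real.sin (φ u)) ∧
    ∀ u : ℝ, φ (u + Real.pi) = φ u + n * Real.pi

/-- The Segre map `([x₀ : x₁], [x₂ : x₃]) ↦ [x₀x₂ : x₀x₃ : x₁x₂ : x₁x₃]`. -/
noncomputable def segre (q r : Fin 2 → Form) : Fin 4 → Form :=
  ![q 0 * r 0, q 0 * r 1, q 1 * r 0, q 1 * r 1]

/-- The curve `k` on the standard hyperboloid has real bi-degree `(m, n)`: it lifts through the Segre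
embedding to `([q₀ : q₁], [r₀ : r₁]) : ℝℙ¹ → ℝℙ¹ × ℝℙ¹`, whose components have degrees `m`, `n`. -/
def HasRealBidegree (k : Fin 4 → Form) (m n : ℤ) : Prop :=
  ∃ (a b : ℕ) (q r : Fin 2 → Form), (∀ i, (q i).IsHomogeneous a) ∧ (∀ i, (r i).IsHomogeneous b) ∧
    k = segre q r ∧ HasRealDegree q m ∧ HasRealDegree r n

open MvPolynomial in
/-- `[s(s³+t³) : s(s³-t³) : t(s³+t³) : t(s³-t³)]`. -/
noncomputable def curveOne : Fin 4 → Form :=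
  ![X 0 * (X 0 ^ 3 + X 1 ^ 3), X 0 * (X 0 ^ 3 - X 1 ^ 3),
    X 1 * (X 0 ^ 3 + X 1 ^ 3), X 1 * (X 0 ^ 3 - X 1 ^ 3)]

open MvPolynomial in
/-- `[s²(s²-4t²) : st(s²-t²) : st(s²-4t²) : t²(s²-t²)]`. -/
noncomputable def curveTwo : Fin 4 → Form :=
  ![X 0 ^ 2 * (X 0 ^ 2 - 4 * X 1 ^ 2), X 0 * X 1 * (X 0 ^ 2 - X 1 ^ 2),
    X 0 * X 1 * (X 0 ^ 2 - 4 * X 1 ^ 2), X 1 ^ 2 * (X 0 ^ 2 - X 1 ^ 2)]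

end RationalKnot

/-! On the hyperboloid `x₀x₃ = x₁x₂` the coordinates of a quartic factor through the Segre map, so
the curve is a pair of maps `ℂℙ¹ → ℂℙ¹` of degrees `m` and `4 - m`. Bi-degree `(0, 4)` is a multiple
cover of a line, and smooth curves of bi-degree `(2, 2)` have genus one, so a rational one is
singular. Up to exchanging the factors only `(1, 3)` remains, and a change of basis in the first
factor turns the curve into the graph of `[f : g]` for two real cubics without common root. Hence
every knot in question is a linear image under some `B` of `twisted f g`
(`exists_eq_transform_twisted`). Conversely all such images are knots
(`isKnotParametrization_twisted`), so `B` and `(f, g)` may be moved independently.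

Every invertible `B` is joined to the identity or to the reflection (`joinedToBase_of_det_ne_zero`);
this is where the mirror images come from. For the cubics only the pencil spanned by `f` and `g`
matters, because changing its basis is a linear map of `ℝ⁴` (`IsStandard.of_target`). Since `g` has
a real root, substitutions joined to the identity bring it, up to a scalar, to `t³`, `s²t` or `s²t ±
t³`. If `g` has a multiple root or a pair of complex roots, `f` can be deformed until the pencil is
that of `s³, t³`, which belongs to `K₁`. If `g` has three distinct real roots, the signs of `f` at
these roots decide: up to a global sign one pattern leads to `K₂` and the other three to `K₁`
(`isStandard_of_three_real_roots`).

The real degrees of the two models come from comparison with `u ↦ n u`: a map never orthogonal to it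
has the same degree (`hasRealDegree_of_inner_pos`). -/

namespace RationalKnot

open MvPolynomial

/-! ### Linear transformations of parametrizations. -/

/-- The parametrization obtained from `k` by the linear transformation with matrix `B`. -/
noncomputable def transform (B : Matrix (Fin 4) (Fin 4) ℝ) (k : Fin 4 → Form) : Fin 4 → Form :=
  fun i => ∑ j, C (B i j) * k j

theorem value_transform (B : Matrix (Fin 4) (Fin 4) ℝ) (k : Fin 4 → Form) (v : Fin 2 → ℂ) :
    value (transform B k) v = Matrix.toLin' (B.map Complex.ofReal) (value k v) := by
  ext i
  simp [value, transform, Matrix.mulVec, dotProduct]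

theorem partialValue_transform (B : Matrix (Fin 4) (Fin 4) ℝ) (k : Fin 4 → Form) (j : Fin 2)
    (v : Fin 2 → ℂ) :
    partialValue (transform B k) j v =
      Matrix.toLin' (B.map Complex.ofReal) (partialValue k j v) := by
  ext i
  simp [partialValue, transform, Matrix.mulVec, dotProduct, Derivation.leibniz]

theorem transform_one (k : Fin 4 → Form) : transform 1 k = k := by
  ext1 i
  simp [transform, Matrix.one_apply]

theorem transform_transform (A B : Matrix (Fin 4) (Fin 4) ℝ) (k : Fin 4 → Form) :
    transform A (transform B k) = transform (A * B) k := by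
  ext1 i
  simp only [transform, Matrix.mul_apply, map_sum, Finset.mul_sum, Finset.sum_mul, map_mul]
  rw [Finset.sum_comm]
  simp only [mul_assoc]

theorem toLin'_injective_of_det_ne_zero {B : Matrix (Fin 4) (Fin 4) ℝ} (hB : B.det ≠ 0) :
    Function.Injective (Matrix.toLin' (B.map Complex.ofReal)) :=
  toLin_injective (Matrix.GeneralLinearGroup.mkOfDetNeZero B hB)

theorem IsKnotParametrization.transform {d : ℕ} {k : Fin 4 → Form}
    (hk : IsKnotParametrization d k) {B : Matrix (Fin 4) (Fin 4) ℝ} (hB : B.det ≠ 0) :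
    IsKnotParametrization d (transform B k) := by
  have hinj := toLin'_injective_of_det_ne_zero hB
  refine ⟨fun i => ?_, fun v hv => ?_, fun v w hv hw => ?_, fun v hv => ?_⟩
  · exact IsHomogeneous.sum _ _ _ fun j _ => (hk.homogeneous j).C_mul _
  · rw [value_transform]
    exact fun h => hk.no_common_root v hv (hinj (by rw [h, map_zero]))
  · rintro ⟨c, hc⟩
    refine hk.no_double_point v w hv hw ⟨c, hinj ?_⟩
    rw [← value_transform, hc, value_transform, map_smul]
  · have h := LinearIndependent.pair_iff.1 (hk.immersion v hv)
    rw [LinearIndependent.pair_iff]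
    intro α β hαβ
    refine h α β (hinj ?_)
    rw [partialValue_transform, partialValue_transform] at hαβ
    rw [map_zero, map_add, map_smul, map_smul, hαβ]

theorem complexPoints_transform (A : GL (Fin 4) ℝ) (k : Fin 4 → Form) :
    complexPoints (transform A k) = projTransform A '' complexPoints k := by
  ext P
  simp only [complexPoints, Set.mem_image, Set.mem_ofPred_eq, projTransform]
  constructor
  · rintro ⟨v, hv, h, rfl⟩
    have h' : value k v ≠ 0 := fun h0 => h (by rw [value_transform, h0, map_zero])
    refine ⟨_, ⟨v, hv, h', rfl⟩, ?_⟩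
    simp only [Projectivization.map_mk, value_transform]
  · rintro ⟨_, ⟨v, hv, h, rfl⟩, rfl⟩
    have h' : value (transform A k) v ≠ 0 := by
      rw [value_transform]
      exact fun h0 => h (toLin_injective A (by rw [h0, map_zero]))
    refine ⟨v, hv, h', ?_⟩
    simp only [Projectivization.map_mk, value_transform]

/-! ### Graphs of rational functions of degree three. -/

/-- The binary cubic form with coefficients `a`. -/
noncomputable def cubic (a : Fin 4 → ℝ) : Form :=
  C (a 0) * X 0 ^ 3 + C (a 1) * (X 0 ^ 2 * X 1) + C (a 2) * (X 0 * X 1 ^ 2) + C (a 3) * X 1 ^ 3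

/-- The value of a binary cubic form at a complex vector. -/
noncomputable def cubicValue (a : Fin 4 → ℝ) (v : Fin 2 → ℂ) : ℂ :=
  a 0 * v 0 ^ 3 + a 1 * (v 0 ^ 2 * v 1) + a 2 * (v 0 * v 1 ^ 2) + a 3 * v 1 ^ 3

/-- The curve of bi-degree `(1, 3)` given by the graph of `[s : t] ↦ [f : g]`. -/
noncomputable def twisted (f g : Fin 4 → ℝ) : Fin 4 → Form :=
  segre ![X 0, X 1] ![cubic f, cubic g]

/-- The binary cubic forms with coefficients `f` and `g` have no common complex root. -/
def NoCommonRoot (f g : Fin 4 → ℝ) : Prop :=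
  ∀ v : Fin 2 → ℂ, v ≠ 0 → cubicValue f v = 0 → cubicValue g v ≠ 0

theorem cubic_isHomogeneous (a : Fin 4 → ℝ) : (cubic a).IsHomogeneous 3 := by
  have h0 : (X 0 : Form).IsHomogeneous 1 := isHomogeneous_X _ _
  have h1 : (X 1 : Form).IsHomogeneous 1 := isHomogeneous_X _ _
  exact ((((h0.pow 3).C_mul _).add (((h0.pow 2).mul h1).C_mul _)).add
    ((h0.mul (h1.pow 2)).C_mul _)).add ((h1.pow 3).C_mul _)

theorem aeval_cubic (a : Fin 4 → ℝ) (v : Fin 2 → ℂ) : aeval v (cubic a) = cubicValue a v := by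
  simp [cubic, cubicValue]

theorem value_twisted (f g : Fin 4 → ℝ) (v : Fin 2 → ℂ) :
    value (twisted f g) v = ![v 0 * cubicValue f v, v 0 * cubicValue g v,
      v 1 * cubicValue f v, v 1 * cubicValue g v] := by
  ext i
  fin_cases i <;> simp [value, twisted, segre, aeval_cubic]

theorem partialValue_twisted_zero (f g : Fin 4 → ℝ) (v : Fin 2 → ℂ) :
    partialValue (twisted f g) 0 v =
      ![v 0 * aeval v (pderiv 0 (cubic f)) + cubicValue f v,
        v 0 * aeval v (pderiv 0 (cubic g)) + cubicValue g v,
        v 1 * aeval v (pderiv 0 (cubic f)), v 1 * aeval v (pderiv 0 (cubic g))] := by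
  ext i
  fin_cases i <;> simp [partialValue, twisted, segre, aeval_cubic, Derivation.leibniz, pderiv_X]

theorem partialValue_twisted_one (f g : Fin 4 → ℝ) (v : Fin 2 → ℂ) :
    partialValue (twisted f g) 1 v =
      ![v 0 * aeval v (pderiv 1 (cubic f)), v 0 * aeval v (pderiv 1 (cubic g)),
        v 1 * aeval v (pderiv 1 (cubic f)) + cubicValue f v,
        v 1 * aeval v (pderiv 1 (cubic g)) + cubicValue g v] := by
  ext i
  fin_cases i <;> simp [partialValue, twisted, segre, aeval_cubic, Derivation.leibniz, pderiv_X]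

theorem euler_cubic (a : Fin 4 → ℝ) (v : Fin 2 → ℂ) :
    v 0 * aeval v (pderiv 0 (cubic a)) + v 1 * aeval v (pderiv 1 (cubic a)) =
      3 * cubicValue a v := by
  have h := congrArg (aeval v) (cubic_isHomogeneous a).sum_X_mul_pderiv
  simpa [Fin.sum_univ_two, aeval_cubic] using h

/-- The first Segre component is the identity, so the point `[s : t]` can be read off from its
image, through whichever of `f`, `g` is nonzero there. This gives injectivity and the immersion
property at once. -/
theorem isKnotParametrization_twisted {f g : Fin 4 → ℝ} (h : NoCommonRoot f g) :
    IsKnotParametrization 4 (twisted f g) := by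
  have h0 : (X 0 : Form).IsHomogeneous 1 := isHomogeneous_X _ _
  have h1 : (X 1 : Form).IsHomogeneous 1 := isHomogeneous_X _ _
  refine ⟨fun i => ?_, fun v hv hz => ?_, fun v w hv hw => ?_, fun v hv => ?_⟩
  · fin_cases i
    · exact h0.mul (cubic_isHomogeneous f)
    · exact h0.mul (cubic_isHomogeneous g)
    · exact h1.mul (cubic_isHomogeneous f)
    · exact h1.mul (cubic_isHomogeneous g)
  · rw [value_twisted] at hz
    have e0 := congrFun hz 0
    have e1 := congrFun hz 1
    have e2 := congrFun hz 2
    have e3 := congrFun hz 3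
    simp at e0 e1 e2 e3
    have hv' : v 0 = 0 → v 1 = 0 → False := fun a b => hv (by ext i; fin_cases i <;> simpa)
    have := h v hv
    tauto
  · rintro ⟨c, hc⟩
    rw [value_twisted, value_twisted] at hc
    have e0 := congrFun hc 0
    have e1 := congrFun hc 1
    have e2 := congrFun hc 2
    have e3 := congrFun hc 3
    simp at e0 e1 e2 e3
    by_cases hf : cubicValue f v = 0
    · have hg := h v hv hf
      refine ⟨c * cubicValue g w / cubicValue g v, ?_⟩
      ext i
      fin_cases i <;> simp <;> field_simp
      · linear_combination e1
      · linear_combination e3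
    · refine ⟨c * cubicValue f w / cubicValue f v, ?_⟩
      ext i
      fin_cases i <;> simp <;> field_simp
      · linear_combination e0
      · linear_combination e2
  · rw [LinearIndependent.pair_iff]
    intro α β hαβ
    rw [partialValue_twisted_zero, partialValue_twisted_one] at hαβ
    have e0 := congrFun hαβ 0
    have e1 := congrFun hαβ 1
    have e2 := congrFun hαβ 2
    have e3 := congrFun hαβ 3
    simp at e0 e1 e2 e3
    -- The two coordinates `s·a`, `t·a` already suffice: eliminating gives `(α, β)` parallel to `v`,
    -- and Euler's identity for this form of degree `3 + 1` leaves `4·a(v)·α = 4·a(v)·β = 0`.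
    have key : ∀ a : Fin 4 → ℝ, cubicValue a v ≠ 0 →
        α * (v 0 * aeval v (pderiv 0 (cubic a)) + cubicValue a v) +
          β * (v 0 * aeval v (pderiv 1 (cubic a))) = 0 →
        α * (v 1 * aeval v (pderiv 0 (cubic a))) +
          β * (v 1 * aeval v (pderiv 1 (cubic a)) + cubicValue a v) = 0 → α = 0 ∧ β = 0 := by
      intro a ha e0 e2
      have E := euler_cubic a v
      have hpar : v 1 * α = v 0 * β := by
        have : cubicValue a v * (v 1 * α - v 0 * β) = 0 := by
          linear_combination v 1 * e0 - v 0 * e2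
        rcases mul_eq_zero.1 this with h | h
        · exact absurd h ha
        · linear_combination h
      constructor
      · have : 4 * cubicValue a v * α = 0 := by
          linear_combination e0 - α * E + aeval v (pderiv 1 (cubic a)) * hpar
        simpa [ha] using this
      · have : 4 * cubicValue a v * β = 0 := by
          linear_combination e2 - β * E - aeval v (pderiv 0 (cubic a)) * hpar
        simpa [ha] using this
    by_cases hf : cubicValue f v = 0
    · exact key g (h v hv hf) e1 e3
    · exact key f hf e0 e2

/-! ### Path components of the group of invertible real matrices. -/

theorem det_reflectionMatrix :
    (reflectionMatrix : Matrix (Fin 4) (Fin 4) ℝ).det = -1 := by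
  simp [reflectionMatrix, Matrix.GeneralLinearGroup.mkOfDetNeZero, Matrix.det_succ_row_zero,
    Fin.sum_univ_succ, Fin.succAbove]

theorem reflectionMatrix_mul_self :
    (reflectionMatrix : Matrix (Fin 4) (Fin 4) ℝ) * reflectionMatrix = 1 := by
  ext i j
  fin_cases i <;> fin_cases j <;>
    simp [reflectionMatrix, Matrix.GeneralLinearGroup.mkOfDetNeZero, Matrix.mul_apply,
      Fin.sum_univ_four]

/-- `B` lies in the path component of the identity or of the reflection in `GL₄(ℝ)`. -/
def JoinedToBase (B : Matrix (Fin 4) (Fin 4) ℝ) : Prop :=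
  JoinedIn {M : Matrix (Fin 4) (Fin 4) ℝ | M.det ≠ 0} 1 B ∨
    JoinedIn {M : Matrix (Fin 4) (Fin 4) ℝ | M.det ≠ 0} reflectionMatrix B

theorem joinedIn_det_mul {A B A' B' : Matrix (Fin 4) (Fin 4) ℝ}
    (hA : JoinedIn {M : Matrix (Fin 4) (Fin 4) ℝ | M.det ≠ 0} A A')
    (hB : JoinedIn {M : Matrix (Fin 4) (Fin 4) ℝ | M.det ≠ 0} B B') :
    JoinedIn {M : Matrix (Fin 4) (Fin 4) ℝ | M.det ≠ 0} (A * B) (A' * B') := by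
  refine (hA.mul hB).mono ?_
  rintro _ ⟨M, hM, N, hN, rfl⟩
  simpa [Matrix.det_mul] using ⟨hM, hN⟩

theorem JoinedToBase.mul {A B : Matrix (Fin 4) (Fin 4) ℝ} (hA : JoinedToBase A)
    (hB : JoinedToBase B) : JoinedToBase (A * B) := by
  rcases hA with hA | hA <;> rcases hB with hB | hB
  · left; simpa using joinedIn_det_mul hA hB
  · right; simpa using joinedIn_det_mul hA hB
  · right; simpa using joinedIn_det_mul hA hB
  · left; simpa [reflectionMatrix_mul_self] using joinedIn_det_mul hA hB

theorem joinedToBase_transvection (t : Matrix.TransvectionStruct (Fin 4) ℝ) :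
    JoinedToBase t.toMatrix := by
  left
  refine JoinedIn.ofLine (f := fun τ : ℝ => Matrix.transvection t.i t.j (τ * t.c)) ?_ ?_ ?_ ?_
  · refine Continuous.continuousOn (continuous_matrix fun i j => ?_)
    simp only [Matrix.transvection, Matrix.add_apply, Matrix.single_apply]
    split_ifs <;> fun_prop
  · simp
  · simp [Matrix.TransvectionStruct.toMatrix]
  · rintro _ ⟨τ, -, rfl⟩
    simp [Matrix.det_transvection_of_ne _ _ t.hij]

theorem joinedToBase_diagonal_update (i : Fin 4) {d : ℝ} (hd : d ≠ 0) :
    JoinedToBase (Matrix.diagonal (Function.update 1 i d)) := by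
  rcases hd.lt_or_gt with hd | hd
  · right
    -- A path of generalized reflections `1 - c·w·wᵀ`. The vector `w` moves from the normal `(0, 1,
    -- -1, 0)` of the plane `x₁ = x₂` to the `i`-th basis vector without vanishing, and `c` is
    -- chosen so that the determinant `1 - c·|w|²` equals `-(1 - τ) + τd`, which is negative
    -- throughout.
    let w : ℝ → Fin 4 → ℝ := fun τ j => (1 - τ) * (![0, 1, -1, 0] : Fin 4 → ℝ) j +
      τ * (Pi.single i 1 : Fin 4 → ℝ) j
    let c : ℝ → ℝ := fun τ => (2 * (1 - τ) + (1 - d) * τ) / (w τ ⬝ᵥ w τ)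
    have hw : ∀ τ, w τ ⬝ᵥ w τ ≠ 0 := by
      intro τ h
      rw [dotProduct_self_eq_zero] at h
      have h0 := congrFun h 0
      have h1 := congrFun h 1
      have h2 := congrFun h 2
      have h3 := congrFun h 3
      fin_cases i <;> simp [w, Pi.single_apply] at h0 h1 h2 h3 <;> linarith
    have hwc : Continuous w := by
      refine continuous_pi fun j => ?_
      fun_prop
    have hcc : Continuous c := by
      refine Continuous.div (by fun_prop) ?_ hw
      exact Continuous.dotProduct hwc hwc
    refine JoinedIn.ofLine (f := fun τ : ℝ => 1 + Matrix.vecMulVec (-c τ • w τ) (w τ)) ?_ ?_ ?_ ?_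
    · refine Continuous.continuousOn (continuous_matrix fun i j => ?_)
      simp only [Matrix.add_apply, Matrix.vecMulVec_apply, Pi.smul_apply, smul_eq_mul]
      have := fun j => (continuous_apply j).comp hwc
      simp only [Function.comp_def] at this
      fun_prop
    · ext j l
      have hc0 : c 0 = 1 := by
        have h2 : (![0, 1, -1, 0] : Fin 4 → ℝ) 2 = -1 := rfl
        have h3 : (![0, 1, -1, 0] : Fin 4 → ℝ) 3 = 0 := rfl
        norm_num [c, w, dotProduct, Fin.sum_univ_four, h2, h3]
      fin_cases j <;> fin_cases l <;>
        simp [hc0, w, reflectionMatrix, Matrix.GeneralLinearGroup.mkOfDetNeZero]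
    · ext j l
      have hw1 : w 1 = Pi.single i 1 := by ext; simp [w]
      have hc1 : c 1 = 1 - d := by simp [c, hw1]
      rw [Matrix.add_apply, Matrix.vecMulVec_apply, hc1, hw1]
      by_cases hjl : j = l <;> by_cases hj : j = i
      · subst hjl; subst hj; simp
      · subst hjl; simp [hj]
      · subst hj; simp [hjl, Ne.symm hjl]
      · simp [hj, hjl]
    · rintro _ ⟨τ, ⟨h0, h1⟩, rfl⟩
      change (1 + Matrix.vecMulVec (-c τ • w τ) (w τ)).det ≠ 0
      rw [Matrix.vecMulVec_eq Unit, Matrix.det_one_add_replicateCol_mul_replicateRow,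
        dotProduct_smul, smul_eq_mul, neg_mul, div_mul_cancel₀ _ (hw τ)]
      rcases h0.eq_or_lt with rfl | h0
      · norm_num
      · nlinarith [mul_pos h0 (neg_pos.2 hd)]
  · left
    refine JoinedIn.ofLine
      (f := fun τ : ℝ => Matrix.diagonal (Function.update 1 i (1 - τ + τ * d))) ?_ ?_ ?_ ?_
    · refine Continuous.continuousOn ?_
      refine Continuous.matrix_diagonal ?_
      exact continuous_const.update i (by fun_prop)
    · simp
    · simp
    · rintro _ ⟨τ, ⟨h0, h1⟩, rfl⟩
      rw [Set.mem_ofPred_eq, Matrix.det_diagonal, Finset.prod_ne_zero_iff]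
      intro j _
      by_cases hj : j = i
      · subst hj
        simp only [Function.update_self]
        rcases h0.eq_or_lt with rfl | h0
        · simp
        · nlinarith [mul_pos h0 hd]
      · simp [hj]

/-- Gaussian elimination writes `B` as a product of transvections and a diagonal matrix. The
property is multiplicative because the reflection is an involution, so single diagonal entries and
transvections suffice. -/
theorem joinedToBase_of_det_ne_zero {B : Matrix (Fin 4) (Fin 4) ℝ} (hB : B.det ≠ 0) :
    JoinedToBase B := by
  refine Matrix.diagonal_transvection_induction_of_det_ne_zero JoinedToBase B hB (fun D hD => ?_)
    joinedToBase_transvection fun A B _ _ hA hB => hA.mul hB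
  rw [Matrix.det_diagonal, Finset.prod_ne_zero_iff] at hD
  have : Matrix.diagonal D = Matrix.diagonal (Function.update 1 0 (D 0)) *
      Matrix.diagonal (Function.update 1 1 (D 1)) * Matrix.diagonal (Function.update 1 2 (D 2)) *
      Matrix.diagonal (Function.update 1 3 (D 3)) := by
    simp only [Matrix.diagonal_mul_diagonal]
    congr 1
    ext i
    fin_cases i <;> simp
  rw [this]
  have h := fun i => joinedToBase_diagonal_update i (hD i (Finset.mem_univ i))
  exact (((h 0).mul (h 1)).mul (h 2)).mul (h 3)

/-! ### Paths of knots in coefficient space. -/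

/-- The family of coefficients of a parametrization. -/
noncomputable def coeffs (k : Fin 4 → Form) : Fin 4 → (Fin 2 →₀ ℕ) → ℝ :=
  fun i m => (k i).coeff m

/-- `k` and `k'` are joined by a path of parametrizations of real rational knots of degree `4`. -/
def KnotPath (k k' : Fin 4 → Form) : Prop :=
  JoinedIn (coeffs '' {k | IsKnotParametrization 4 k}) (coeffs k) (coeffs k')

theorem coeffs_injective : Function.Injective coeffs := by
  intro k k' h
  ext i m
  exact congrFun (congrFun h i) m

/-- Coefficientwise continuity is continuity in the product topology, and injectivity of `coeffs`
identifies the forms at the two ends of the path. -/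
theorem KnotPath.rigidlyIsotopic {k k' : Fin 4 → Form} (h : KnotPath k k') :
    RigidlyIsotopic 4 (complexPoints k) (complexPoints k') := by
  obtain ⟨p, hp⟩ := h
  choose γ hγ hγp using hp
  refine ⟨γ, fun i m => ?_, hγ, ?_, ?_⟩
  · have : (fun τ => (γ τ i).coeff m) = fun τ => p τ i m := by
      ext τ
      rw [← hγp τ]
      rfl
    rw [this]
    exact (continuous_apply m).comp ((continuous_apply i).comp p.continuous)
  · rw [coeffs_injective ((hγp 0).trans p.source)]
  · rw [coeffs_injective ((hγp 1).trans p.target)]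

theorem continuous_coeffs_transform_twisted :
    Continuous fun p : Matrix (Fin 4) (Fin 4) ℝ × (Fin 4 → ℝ) × (Fin 4 → ℝ) =>
      coeffs (transform p.1 (twisted p.2.1 p.2.2)) := by
  have hX : ∀ (i : Fin 2) (m : Fin 2 →₀ ℕ),
      Continuous fun f : Fin 4 → ℝ => coeff m (X i * cubic f) := by
    intro i m
    have : (fun f : Fin 4 → ℝ => coeff m (X i * cubic f)) = fun f : Fin 4 → ℝ =>
        f 0 * coeff m (X i * X 0 ^ 3 : Form) + f 1 * coeff m (X i * (X 0 ^ 2 * X 1) : Form) +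
        f 2 * coeff m (X i * (X 0 * X 1 ^ 2) : Form) + f 3 * coeff m (X i * X 1 ^ 3 : Form) := by
      ext f
      simp only [← coeff_C_mul, ← coeff_add]
      congr 1
      simp only [cubic]
      ring
    rw [this]
    fun_prop
  refine continuous_pi fun i => continuous_pi fun m => ?_
  simp only [coeffs, transform, Fin.sum_univ_four, coeff_add, coeff_C_mul]
  have hB : ∀ j, Continuous fun p : Matrix (Fin 4) (Fin 4) ℝ × (Fin 4 → ℝ) × (Fin 4 → ℝ) =>
      p.1 i j := fun j => continuous_fst.matrix_elem i j
  have hf : ∀ l, Continuous fun p : Matrix (Fin 4) (Fin 4) ℝ × (Fin 4 → ℝ) × (Fin 4 → ℝ) =>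
      coeff m (X l * cubic p.2.1) := fun l => (hX l m).comp (by fun_prop)
  have hg : ∀ l, Continuous fun p : Matrix (Fin 4) (Fin 4) ℝ × (Fin 4 → ℝ) × (Fin 4 → ℝ) =>
      coeff m (X l * cubic p.2.2) := fun l => (hX l m).comp (by fun_prop)
  exact ((((hB 0).mul (hf 0)).add ((hB 1).mul (hg 0))).add ((hB 2).mul (hf 1))).add
    ((hB 3).mul (hg 1))

theorem knotPath_transform_twisted {B B' : Matrix (Fin 4) (Fin 4) ℝ} {f g f' g' : Fin 4 → ℝ}
    (hB : JoinedIn {M : Matrix (Fin 4) (Fin 4) ℝ | M.det ≠ 0} B B')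
    (h : JoinedIn {p : (Fin 4 → ℝ) × (Fin 4 → ℝ) | NoCommonRoot p.1 p.2} (f, g) (f', g')) :
    KnotPath (transform B (twisted f g)) (transform B' (twisted f' g')) := by
  refine ((hB.prod h).map continuous_coeffs_transform_twisted).mono ?_
  rintro _ ⟨⟨M, p⟩, ⟨hM, hp⟩, rfl⟩
  exact ⟨_, (isKnotParametrization_twisted hp).transform hM, rfl⟩

/-! ### Standard pencils and the moves that preserve them. -/

/-- The pairs of binary cubic forms of the two standard curves. -/
def standardPairs : Set ((Fin 4 → ℝ) × (Fin 4 → ℝ)) :=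
  {(![1, 0, 0, 1], ![1, 0, 0, -1]), (![1, 0, -4, 0], ![0, 1, 0, -1])}

/-- Every linear image of the curve given by `[f : g]` is isotopic to a standard curve or its
reflection. -/
def IsStandard (f g : Fin 4 → ℝ) : Prop :=
  ∀ B : Matrix (Fin 4) (Fin 4) ℝ, B.det ≠ 0 →
    ∃ A ∈ ({1, ↑reflectionMatrix} : Set (Matrix (Fin 4) (Fin 4) ℝ)), ∃ p ∈ standardPairs,
      KnotPath (transform B (twisted f g)) (transform A (twisted p.1 p.2))

theorem IsStandard.of_path {f g f' g' : Fin 4 → ℝ} (h : IsStandard f' g')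
    (F G : ℝ → Fin 4 → ℝ) (hF : Continuous F) (hG : Continuous G)
    (hFG : ∀ τ ∈ Set.Icc (0 : ℝ) 1, NoCommonRoot (F τ) (G τ)) (hF0 : F 0 = f) (hG0 : G 0 = g)
    (hF1 : F 1 = f') (hG1 : G 1 = g') : IsStandard f g := by
  intro B hB
  obtain ⟨A, hA, p, hp, hAp⟩ := h B hB
  refine ⟨A, hA, p, hp, JoinedIn.trans (knotPath_transform_twisted (JoinedIn.refl hB) ?_) hAp⟩
  refine JoinedIn.ofLine (f := fun τ => (F τ, G τ)) (hF.prodMk hG).continuousOn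
    (by rw [hF0, hG0]) (by rw [hF1, hG1]) ?_
  rintro _ ⟨τ, hτ, rfl⟩
  exact hFG τ hτ

theorem isStandard_of_mem {p : (Fin 4 → ℝ) × (Fin 4 → ℝ)} (hp : p ∈ standardPairs)
    (h : NoCommonRoot p.1 p.2) : IsStandard p.1 p.2 := by
  intro B hB
  rcases joinedToBase_of_det_ne_zero hB with hB | hB
  · exact ⟨1, by simp, p, hp, knotPath_transform_twisted hB.symm (JoinedIn.refl h)⟩
  · exact ⟨_, by simp, p, hp, knotPath_transform_twisted hB.symm (JoinedIn.refl h)⟩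

/-- A change of basis of the pencil acts on the curve through the block matrix `K`, of determinant
`(ps - qr)²`. Since `IsStandard` quantifies over all `B`, `K` is absorbed into `B`, and no path in
the group of base changes is needed. -/
theorem IsStandard.of_target {f g f' g' : Fin 4 → ℝ} (h : IsStandard f' g') (p q r s : ℝ)
    (hdet : p * s - q * r ≠ 0) (hf : f' = p • f + q • g) (hg : g' = r • f + s • g) :
    IsStandard f g := by
  intro B hB
  let K : Matrix (Fin 4) (Fin 4) ℝ := !![p, q, 0, 0; r, s, 0, 0; 0, 0, p, q; 0, 0, r, s]
  have hKdet : K.det ≠ 0 := by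
    have : K.det = (p * s - q * r) ^ 2 := by
      simp [K, Matrix.det_succ_row_zero, Fin.sum_univ_succ, Fin.succAbove]
      ring
    rw [this]
    exact pow_ne_zero 2 hdet
  have hK : transform K (twisted f g) = twisted f' g' := by
    subst hf hg
    ext1 i
    fin_cases i <;> simp [transform, K, twisted, segre, Fin.sum_univ_four, cubic] <;> ring
  obtain ⟨A, hA, x, hx, hAx⟩ := h (B * K⁻¹) (by
    rw [Matrix.det_mul, Matrix.det_nonsing_inv, Ring.inverse_eq_inv']
    exact mul_ne_zero hB (inv_ne_zero hKdet))
  refine ⟨A, hA, x, hx, ?_⟩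
  rwa [← hK, transform_transform, Matrix.mul_assoc,
    Matrix.nonsing_inv_mul _ (isUnit_iff_ne_zero.2 hKdet), mul_one] at hAx

theorem NoCommonRoot.target {f g f' g' : Fin 4 → ℝ} (h : NoCommonRoot f g) (p q r s : ℝ)
    (hdet : p * s - q * r ≠ 0) (hf : f' = p • f + q • g) (hg : g' = r • f + s • g) :
    NoCommonRoot f' g' := by
  intro v hv h1 h2
  have e1 : (p : ℂ) * cubicValue f v + q * cubicValue g v = 0 := by
    rw [← h1, hf]; simp [cubicValue]; ring
  have e2 : (r : ℂ) * cubicValue f v + s * cubicValue g v = 0 := by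
    rw [← h2, hg]; simp [cubicValue]; ring
  have hd : (p * s - q * r : ℂ) ≠ 0 := by exact_mod_cast hdet
  refine h v hv ?_ ?_
  · refine (mul_eq_zero.1 (?_ : (p * s - q * r : ℂ) * _ = 0)).resolve_left hd
    linear_combination s * e1 - q * e2
  · refine (mul_eq_zero.1 (?_ : (p * s - q * r : ℂ) * _ = 0)).resolve_left hd
    linear_combination p * e2 - r * e1

/-- The coefficients of the cubic form `a(αs + βt, γs + δt)`. -/
def substitute (α β γ δ : ℝ) (a : Fin 4 → ℝ) : Fin 4 → ℝ :=
  ![a 0 * α ^ 3 + a 1 * (α ^ 2 * γ) + a 2 * (α * γ ^ 2) + a 3 * γ ^ 3,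
    3 * a 0 * (α ^ 2 * β) + a 1 * (2 * α * β * γ + α ^ 2 * δ) +
      a 2 * (β * γ ^ 2 + 2 * α * γ * δ) + 3 * a 3 * (γ ^ 2 * δ),
    3 * a 0 * (α * β ^ 2) + a 1 * (β ^ 2 * γ + 2 * α * β * δ) +
      a 2 * (2 * β * γ * δ + α * δ ^ 2) + 3 * a 3 * (γ * δ ^ 2),
    a 0 * β ^ 3 + a 1 * (β ^ 2 * δ) + a 2 * (β * δ ^ 2) + a 3 * δ ^ 3]

theorem cubicValue_substitute (α β γ δ : ℝ) (a : Fin 4 → ℝ) (v : Fin 2 → ℂ) :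
    cubicValue (substitute α β γ δ a) v =
      cubicValue a ![α * v 0 + β * v 1, γ * v 0 + δ * v 1] := by
  simp [cubicValue, substitute]
  ring

theorem NoCommonRoot.substitute {f g : Fin 4 → ℝ} (h : NoCommonRoot f g) {α β γ δ : ℝ}
    (hdet : α * δ - β * γ ≠ 0) :
    NoCommonRoot (substitute α β γ δ f) (substitute α β γ δ g) := by
  intro v hv
  rw [cubicValue_substitute, cubicValue_substitute]
  refine h _ fun h0 => hv ?_
  have e0 := congrFun h0 0
  have e1 := congrFun h0 1
  simp at e0 e1
  have hd : (α * δ - β * γ : ℂ) ≠ 0 := by exact_mod_cast hdet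
  ext i
  fin_cases i
  · change v 0 = 0
    refine (mul_eq_zero.1 (?_ : (α * δ - β * γ : ℂ) * _ = 0)).resolve_left hd
    linear_combination δ * e0 - β * e1
  · change v 1 = 0
    refine (mul_eq_zero.1 (?_ : (α * δ - β * γ : ℂ) * _ = 0)).resolve_left hd
    linear_combination α * e1 - γ * e0

/-- The substitution is made in the second Segre component only, so it changes the curve and is not
a mere reparametrization. It therefore has to be joined to the identity by invertible substitutions,
each of which preserves the absence of common roots. -/
theorem IsStandard.of_substitute {f g : Fin 4 → ℝ} (hfg : NoCommonRoot f g) (α β γ δ : ℝ → ℝ)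
    (hα : Continuous α) (hβ : Continuous β) (hγ : Continuous γ) (hδ : Continuous δ)
    (hdet : ∀ τ ∈ Set.Icc (0 : ℝ) 1, α τ * δ τ - β τ * γ τ ≠ 0)
    (hα0 : α 0 = 1) (hβ0 : β 0 = 0) (hγ0 : γ 0 = 0) (hδ0 : δ 0 = 1)
    (h : IsStandard (RationalKnot.substitute (α 1) (β 1) (γ 1) (δ 1) f)
      (RationalKnot.substitute (α 1) (β 1) (γ 1) (δ 1) g)) : IsStandard f g := by
  have hcont : ∀ a : Fin 4 → ℝ,
      Continuous fun τ => RationalKnot.substitute (α τ) (β τ) (γ τ) (δ τ) a := by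
    intro a
    refine continuous_pi fun i => ?_
    fin_cases i <;> simp only [RationalKnot.substitute] <;> simp <;> fun_prop
  have hzero : ∀ a : Fin 4 → ℝ,
      RationalKnot.substitute (α 0) (β 0) (γ 0) (δ 0) a = a := by
    intro a
    rw [hα0, hβ0, hγ0, hδ0]
    ext i
    fin_cases i <;> simp [RationalKnot.substitute]
  exact h.of_path _ _ (hcont f) (hcont g) (fun τ hτ => hfg.substitute (hdet τ hτ)) (hzero f)
    (hzero g) rfl rfl

theorem IsStandard.of_shear {f g : Fin 4 → ℝ} (hfg : NoCommonRoot f g) (c : ℝ)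
    (h : IsStandard (RationalKnot.substitute 1 c 0 1 f) (RationalKnot.substitute 1 c 0 1 g)) :
    IsStandard f g := by
  refine IsStandard.of_substitute hfg (fun _ => 1) (fun τ => τ * c) (fun _ => 0) (fun _ => 1)
    (by fun_prop) (by fun_prop) (by fun_prop) (by fun_prop) (by simp) rfl (by simp) rfl rfl ?_
  simpa using h

theorem IsStandard.of_scaling {f g : Fin 4 → ℝ} (hfg : NoCommonRoot f g) {l : ℝ} (hl : 0 < l)
    (h : IsStandard (RationalKnot.substitute l 0 0 1 f) (RationalKnot.substitute l 0 0 1 g)) :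
    IsStandard f g := by
  refine IsStandard.of_substitute hfg (fun τ => 1 - τ + τ * l) (fun _ => 0) (fun _ => 0)
    (fun _ => 1) (by fun_prop) (by fun_prop) (by fun_prop) (by fun_prop) ?_ (by simp) rfl rfl rfl ?_
  · rintro τ ⟨h0, h1⟩
    rcases h0.eq_or_lt with rfl | h0
    · simp
    · nlinarith [mul_pos h0 hl]
  · simpa using h

theorem IsStandard.of_rotation {f g : Fin 4 → ℝ} (hfg : NoCommonRoot f g) (θ : ℝ)
    (h : IsStandard
      (RationalKnot.substitute (Real.cos θ) (-Real.sin θ) (Real.sin θ) (Real.cos θ) f)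
      (RationalKnot.substitute (Real.cos θ) (-Real.sin θ) (Real.sin θ) (Real.cos θ) g)) :
    IsStandard f g := by
  refine IsStandard.of_substitute hfg (fun τ => Real.cos (τ * θ)) (fun τ => -Real.sin (τ * θ))
    (fun τ => Real.sin (τ * θ)) (fun τ => Real.cos (τ * θ)) (by fun_prop) (by fun_prop)
    (by fun_prop) (by fun_prop) ?_ (by simp) (by simp) (by simp) (by simp) ?_
  · intro τ _
    have := Real.sin_sq_add_cos_sq (τ * θ)
    nlinarith
  · simpa using h

theorem eq_zero_of_coords {v : Fin 2 → ℂ} (h0 : v 0 = 0) (h1 : v 1 = 0) : v = 0 := by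
  ext i
  fin_cases i
  · exact h0
  · exact h1

theorem noCommonRoot_of_coords {f g : Fin 4 → ℝ}
    (h : ∀ x y : ℂ, f 0 * x ^ 3 + f 1 * (x ^ 2 * y) + f 2 * (x * y ^ 2) + f 3 * y ^ 3 = 0 →
      g 0 * x ^ 3 + g 1 * (x ^ 2 * y) + g 2 * (x * y ^ 2) + g 3 * y ^ 3 = 0 → x = 0 ∧ y = 0) :
    NoCommonRoot f g := fun v hv hf hg =>
  have := h (v 0) (v 1) hf hg
  hv (eq_zero_of_coords this.1 this.2)

theorem noCommonRoot_standard_one : NoCommonRoot ![1, 0, 0, 1] ![1, 0, 0, -1] := by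
  refine noCommonRoot_of_coords fun x y h1 h2 => ?_
  simp at h1 h2
  constructor
  · have : x ^ 3 = 0 := by linear_combination (h1 + h2) / 2
    simpa using this
  · have : y ^ 3 = 0 := by linear_combination (h1 - h2) / 2
    simpa using this

theorem noCommonRoot_standard_two : NoCommonRoot ![1, 0, -4, 0] ![0, 1, 0, -1] := by
  refine noCommonRoot_of_coords fun x y h1 h2 => ?_
  simp at h1 h2
  constructor
  -- Bézout certificates: `x⁵` and `y⁵` both lie in the ideal generated by the two cubics.
  · have : x ^ 5 = 0 := by
      linear_combination (x ^ 2 + 4 * y ^ 2 - 16 / 3 * y ^ 2) * h1 + 16 / 3 * x * y * h2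
    simpa using this
  · have : y ^ 5 = 0 := by
      linear_combination (x ^ 2 / 3 - y ^ 2) * h2 - x * y / 3 * h1
    simpa using this

/-- The cubes `s³, t³` span the same pencil as the cubics `s³ ± t³` of `K₁`. -/
theorem isStandard_cube : IsStandard ![1, 0, 0, 0] ![0, 0, 0, 1] :=
  IsStandard.of_target (isStandard_of_mem (p := (![1, 0, 0, 1], ![1, 0, 0, -1]))
    (by simp [standardPairs]) noCommonRoot_standard_one) 1 1 1 (-1) (by norm_num) (by simp)
    (by simp)

theorem isStandard_standard_two : IsStandard ![1, 0, -4, 0] ![0, 1, 0, -1] :=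
  isStandard_of_mem (p := (![1, 0, -4, 0], ![0, 1, 0, -1]))
    (by simp [standardPairs]) noCommonRoot_standard_two

theorem IsStandard.of_smul_right {f g g' : Fin 4 → ℝ} (h : IsStandard f g') {c : ℝ} (hc : c ≠ 0)
    (hg : g' = c • g) : IsStandard f g :=
  h.of_target 1 0 0 c (by simpa) (by simp) (by simpa)

theorem IsStandard.of_smul_left {f g f' : Fin 4 → ℝ} (h : IsStandard f' g) {c : ℝ} (hc : c ≠ 0)
    (hf : f' = c • f) : IsStandard f g :=
  h.of_target c 0 0 1 (by simpa) (by simpa) (by simp)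

/-- A form vanishing at `[1 : 0]` has no common root with `f` only if `f` does not vanish there. -/
theorem NoCommonRoot.left_zero_ne {f g : Fin 4 → ℝ} (h : NoCommonRoot f g) (hg : g 0 = 0) :
    f 0 ≠ 0 := fun hf =>
  h ![1, 0] (fun h0 => one_ne_zero (congrFun h0 0)) (by simp [cubicValue, hf])
    (by simp [cubicValue, hg])

theorem NoCommonRoot.left_three_ne {f g : Fin 4 → ℝ} (h : NoCommonRoot f g) (hg : g 3 = 0) :
    f 3 ≠ 0 := fun hf =>
  h ![0, 1] (fun h0 => one_ne_zero (congrFun h0 1)) (by simp [cubicValue, hf])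
    (by simp [cubicValue, hg])

theorem continuous_vec {a b c d : ℝ → ℝ} (ha : Continuous a) (hb : Continuous b)
    (hc : Continuous c) (hd : Continuous d) :
    Continuous fun τ => (![a τ, b τ, c τ, d τ] : Fin 4 → ℝ) := by
  refine continuous_pi fun i => ?_
  fin_cases i <;> assumption

theorem vec_eta (f : Fin 4 → ℝ) : ![f 0, f 1, f 2, f 3] = f := by
  ext i
  fin_cases i <;> rfl

/-! ### Deformation of pencils according to the roots of one member. -/

/-- A pencil containing the cube of a linear form. -/
theorem isStandard_of_triple_root {f : Fin 4 → ℝ} (h : NoCommonRoot f ![0, 0, 0, 1]) :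
    IsStandard f ![0, 0, 0, 1] := by
  have h0 := h.left_zero_ne rfl
  have h1 : IsStandard ![f 0, 0, 0, 0] ![0, 0, 0, 1] :=
    isStandard_cube.of_smul_left (inv_ne_zero h0) (by simp [h0])
  -- The only root of `t³` is `[1 : 0]`, where `f` takes the value `f 0`, which stays fixed.
  refine h1.of_path (fun τ => ![f 0, (1 - τ) * f 1, (1 - τ) * f 2, (1 - τ) * f 3])
    (fun _ => ![0, 0, 0, 1]) (continuous_vec (by fun_prop) (by fun_prop) (by fun_prop)
    (by fun_prop)) continuous_const ?_ (by simpa using vec_eta f) rfl (by simp) rfl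
  intro τ _
  refine noCommonRoot_of_coords fun x y h1 h2 => ?_
  simp at h1 h2
  subst h2
  simpa [h0] using h1

/-- A pencil containing a form with a real double root and another real root. -/
theorem isStandard_of_double_root {f : Fin 4 → ℝ} (h : NoCommonRoot f ![0, 1, 0, 0]) :
    IsStandard f ![0, 1, 0, 0] := by
  have h0 := h.left_zero_ne rfl
  have h3 := h.left_three_ne rfl
  have h1 : IsStandard ![f 0, 0, 0, f 3] ![-f 0 * f 3, 0, 0, 0] := by
    refine isStandard_cube.of_target 0 (-1 / (f 0 * f 3)) (1 / f 3) (1 / f 3 ^ 2) ?_ ?_ ?_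
    · field_simp
      simpa using ⟨h0, h3⟩
    · ext i
      fin_cases i <;> simp
      field_simp
    · ext i
      fin_cases i <;> simp <;> field_simp
      ring
  have h2 : IsStandard ![f 0, 0, 0, f 3] ![0, 1, 0, 0] := by
    -- The simple root of `s²((1 - τ)t - f₀f₃τs)` moves from `[1 : 0]` to `[0 : 1]`. The sign of
    -- `f₀f₃` sends it through the arc on which `f₀s³` and `f₃t³` have equal signs, so it never
    -- meets a root of `f₀s³ + f₃t³`.
    refine h1.of_path (fun _ => ![f 0, 0, 0, f 3]) (fun τ => ![-f 0 * f 3 * τ, 1 - τ, 0, 0])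
      continuous_const (continuous_vec (by fun_prop) (by fun_prop) (by fun_prop)
      (by fun_prop)) ?_ rfl (by simp) rfl (by simp)
    rintro τ ⟨t0, t1⟩
    refine noCommonRoot_of_coords fun x y h1 h2 => ?_
    simp at h1 h2
    have hx : x = 0 := by
      by_contra hx
      have e : (1 - τ) * y = f 0 * f 3 * τ * x := by
        have : x ^ 2 * ((1 - τ) * y - f 0 * f 3 * τ * x) = 0 := by linear_combination h2
        have := (mul_eq_zero.1 this).resolve_left (pow_ne_zero 2 hx)
        linear_combination this
      have e2 : (f 0 : ℂ) * x ^ 3 * ((1 - τ) ^ 3 + f 0 ^ 2 * f 3 ^ 4 * τ ^ 3) = 0 := by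
        have e3 : ((1 - τ) * y) ^ 3 = (f 0 * f 3 * τ * x) ^ 3 := by rw [e]
        linear_combination (1 - τ : ℂ) ^ 3 * h1 - f 3 * e3
      have e4 : ((1 - τ : ℂ) ^ 3 + f 0 ^ 2 * f 3 ^ 4 * τ ^ 3) = 0 :=
        (mul_eq_zero.1 e2).resolve_left
          (mul_ne_zero (Complex.ofReal_ne_zero.2 h0) (pow_ne_zero 3 hx))
      have e5 : (1 - τ) ^ 3 + f 0 ^ 2 * f 3 ^ 4 * τ ^ 3 = 0 := by exact_mod_cast e4
      rcases t0.eq_or_lt with rfl | t0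
      · norm_num at e5
      · have : 0 < f 0 ^ 2 * f 3 ^ 4 * τ ^ 3 := by positivity
        have : 0 ≤ (1 - τ) ^ 3 := pow_nonneg (by linarith) 3
        linarith
    subst hx
    simpa [h3] using h1
  have h4 : IsStandard ![f 0, 0, f 2, f 3] ![0, 1, 0, 0] := by
    refine h2.of_path (fun τ => ![f 0, 0, (1 - τ) * f 2, f 3]) (fun _ => ![0, 1, 0, 0])
      (continuous_vec (by fun_prop) (by fun_prop) (by fun_prop)
      (by fun_prop)) continuous_const ?_ (by simp) rfl (by simp) rfl
    intro τ _
    refine noCommonRoot_of_coords fun x y h1 h2 => ?_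
    simp at h1 h2
    rcases h2 with rfl | rfl
    · simpa [h3] using h1
    · simpa [h0] using h1
  -- The remaining coefficient of `s²t` is removed by subtracting a multiple of the other pencil
  -- member.
  refine h4.of_target 1 (-f 1) 0 1 (by simp) ?_ (by simp)
  ext i
  fin_cases i <;> simp

/-- A pencil containing a form with two conjugate complex roots. -/
theorem isStandard_of_complex_root {f : Fin 4 → ℝ} (h : NoCommonRoot f ![0, 1, 0, 1]) :
    IsStandard f ![0, 1, 0, 1] := by
  have h0 := h.left_zero_ne rfl
  have h1 : IsStandard ![1, 0, 0, 0] ![0, 1, 0, 1] := by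
    refine isStandard_cube.of_path (fun _ => ![1, 0, 0, 0]) (fun τ => ![0, 1 - τ, 0, 1])
      continuous_const (continuous_vec (by fun_prop) (by fun_prop) (by fun_prop)
      (by fun_prop)) ?_ rfl (by simp) rfl (by simp)
    intro τ _
    refine noCommonRoot_of_coords fun x y h1 h2 => ?_
    simp at h1 h2
    subst h1
    simpa using h2
  -- At the roots `[±i : 1]` the form `s³ + p₁s²t + p₂st²` equals `-p₁ ± (p₂ - 1)i`, so `(0, 1)` is
  -- the only forbidden parameter.
  have h2 : ∀ p : ℝ × ℝ, p ≠ (0, 1) → NoCommonRoot ![1, p.1, p.2, 0] ![0, 1, 0, 1] := by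
    intro p hp
    refine noCommonRoot_of_coords fun x y h1 h2 => ?_
    simp at h1 h2
    have hy : y = 0 := by
      by_contra hy
      have e1 : x ^ 2 = - y ^ 2 := by
        have : y * (x ^ 2 + y ^ 2) = 0 := by linear_combination h2
        linear_combination (mul_eq_zero.1 this).resolve_left hy
      have e2 : (p.2 - 1) * x = p.1 * y := by
        have : y ^ 2 * ((p.2 - 1) * x - p.1 * y) = 0 := by
          linear_combination h1 - (x + p.1 * y) * e1
        linear_combination (mul_eq_zero.1 this).resolve_left (pow_ne_zero 2 hy)
      have e3 : y ^ 2 * ((p.2 - 1) ^ 2 + p.1 ^ 2 : ℂ) = 0 := by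
        linear_combination (p.2 - 1 : ℂ) ^ 2 * e1 - ((p.2 - 1) * x + p.1 * y) * e2
      have e4 : ((p.2 - 1) ^ 2 + p.1 ^ 2 : ℂ) = 0 :=
        (mul_eq_zero.1 e3).resolve_left (pow_ne_zero 2 hy)
      have e5 : (p.2 - 1) ^ 2 + p.1 ^ 2 = 0 := by exact_mod_cast e4
      refine hp (Prod.ext ?_ ?_)
      · exact pow_eq_zero_iff two_ne_zero |>.1 (by nlinarith)
      · have : p.2 - 1 = 0 := pow_eq_zero_iff two_ne_zero |>.1 (by nlinarith)
        linarith
    subst hy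
    simpa using h1
  have h3 : ∀ p : ℝ × ℝ, p ≠ (0, 1) → IsStandard ![1, p.1, p.2, 0] ![0, 1, 0, 1] := by
    intro p hp
    -- A real plane with one point removed is path connected, so all admissible pairs can be moved
    -- to `(0, 0)`, that is, to `f = s³`.
    have hpath : IsPathConnected ({((0 : ℝ), (1 : ℝ))}ᶜ : Set (ℝ × ℝ)) :=
      isPathConnected_compl_singleton_of_one_lt_rank
        (by simp [one_add_one_eq_two]) _
    obtain ⟨γ, hγ⟩ := hpath.joinedIn p (by simpa using hp) (0, 0) (by simp)
    have hc : Continuous fun τ : ℝ => γ.extend τ := γ.continuous_extend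
    refine h1.of_path (fun τ => ![1, (γ.extend τ).1, (γ.extend τ).2, 0])
      (fun _ => ![0, 1, 0, 1]) (continuous_vec (by fun_prop) (by fun_prop) (by fun_prop)
      (by fun_prop)) continuous_const ?_ (by simp) rfl (by simp) rfl
    intro τ hτ
    refine h2 _ ?_
    rw [Path.extend_apply _ hτ]
    exact hγ _
  have h4 := h.target (1 / f 0) (-f 3 / f 0) 0 1 (by simpa) rfl rfl
  have e : (1 / f 0) • f + (-f 3 / f 0) • ![0, 1, 0, 1] =
      ![1, f 1 / f 0 - f 3 / f 0, f 2 / f 0, 0] := by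
    ext i
    fin_cases i <;> simp [h0] <;> field_simp <;> ring
  refine IsStandard.of_target (h3 (f 1 / f 0 - f 3 / f 0, f 2 / f 0) fun hp => ?_)
    (1 / f 0) (-f 3 / f 0) 0 1 (by simpa) e.symm (by simp)
  rw [Prod.mk.injEq] at hp
  rw [e, hp.1, hp.2] at h4
  refine h4 ![Complex.I, 1] (fun h0 => one_ne_zero (congrFun h0 1)) ?_ ?_ <;>
    simp [cubicValue, pow_succ]

/-- The value of a binary cubic form at a real vector. -/
def realValue (a : Fin 4 → ℝ) (x y : ℝ) : ℝ :=
  a 0 * x ^ 3 + a 1 * (x ^ 2 * y) + a 2 * (x * y ^ 2) + a 3 * y ^ 3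

theorem realValue_vec (a b c d x y : ℝ) : realValue ![a, b, c, d] x y =
    a * x ^ 3 + b * (x ^ 2 * y) + c * (x * y ^ 2) + d * y ^ 3 := rfl

theorem NoCommonRoot.realValue_ne {f g : Fin 4 → ℝ} (h : NoCommonRoot f g) {x y : ℝ}
    (hxy : x ≠ 0 ∨ y ≠ 0) (hg : realValue g x y = 0) : realValue f x y ≠ 0 := by
  intro hf
  refine h ![x, y] (fun h0 => ?_) ?_ ?_
  · have e0 := congrFun h0 0
    have e1 := congrFun h0 1
    simp at e0 e1
    tauto
  · have := congrArg Complex.ofReal hf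
    simpa [realValue, cubicValue] using this
  · have := congrArg Complex.ofReal hg
    simpa [realValue, cubicValue] using this

/-- A cubic form is odd, so its values at opposite points of the circle have opposite signs. -/
theorem exists_realValue_eq_zero (g : Fin 4 → ℝ) :
    ∃ θ : ℝ, realValue g (Real.cos θ) (Real.sin θ) = 0 := by
  have hc : Continuous fun θ => realValue g (Real.cos θ) (Real.sin θ) := by
    unfold realValue
    fun_prop
  have h0 : realValue g (Real.cos 0) (Real.sin 0) = g 0 := by simp [realValue]
  have hpi : realValue g (Real.cos Real.pi) (Real.sin Real.pi) = -g 0 := by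
    simp [realValue]
    ring
  have := intermediate_value_uIcc (a := 0) (b := Real.pi) hc.continuousOn
  simp only [h0, hpi] at this
  obtain ⟨θ, -, hθ⟩ := this (show (0 : ℝ) ∈ Set.uIcc (g 0) (-g 0) by
    rw [Set.mem_uIcc]
    rcases le_total (g 0) 0 with h | h
    · left; constructor <;> linarith
    · right; constructor <;> linarith)
  exact ⟨θ, hθ⟩

/-- The roots of `s²t - t³` are the real points `[1 : 0]`, `[1 : 1]`, `[-1 : 1]`. The segment from
`f` to `f'` keeps nonzero values there when the signs agree at all three. -/
theorem isStandard_of_same_signs {f f' : Fin 4 → ℝ} (h : IsStandard f' ![0, 1, 0, -1])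
    (h0 : 0 < f 0 * f' 0) (h1 : 0 < realValue f 1 1 * realValue f' 1 1)
    (h2 : 0 < realValue f (-1) 1 * realValue f' (-1) 1) : IsStandard f ![0, 1, 0, -1] := by
  refine h.of_path (fun τ => (1 - τ) • f + τ • f') (fun _ => ![0, 1, 0, -1]) (by fun_prop)
    continuous_const ?_ (by simp) rfl (by simp) rfl
  rintro τ ⟨t0, t1⟩
  have key : ∀ a b : ℝ, 0 < a * b → (1 - τ) * a + τ * b ≠ 0 := by
    intro a b hab h
    have : 0 < a * a := mul_self_pos.2 (left_ne_zero_of_mul hab.ne')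
    rcases t0.eq_or_lt with rfl | t0
    · have : a = 0 := by linarith
      simp [this] at hab
    · have : a * ((1 - τ) * a + τ * b) = 0 := by rw [h, mul_zero]
      nlinarith [mul_pos t0 hab]
  have k0 := key _ _ h0
  have k1 := key _ _ h1
  have k2 := key _ _ h2
  simp only [realValue] at k1 k2
  refine noCommonRoot_of_coords fun x y h1 h2 => ?_
  simp at h1 h2
  have hy : y = 0 := by
    by_contra hy
    have hxy : (x - y) * (x + y) = 0 := by
      have : y * ((x - y) * (x + y)) = 0 := by linear_combination h2
      exact (mul_eq_zero.1 this).resolve_left hy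
    rcases mul_eq_zero.1 hxy with hx | hx
    · obtain rfl : x = y := by linear_combination hx
      apply k1
      have : x ^ 3 * ((((1 - τ) * (f 0 * 1 ^ 3 + f 1 * (1 ^ 2 * 1) + f 2 * (1 * 1 ^ 2) + f 3 * 1 ^ 3)
        + τ * (f' 0 * 1 ^ 3 + f' 1 * (1 ^ 2 * 1) + f' 2 * (1 * 1 ^ 2) + f' 3 * 1 ^ 3) : ℝ)) : ℂ)
          = 0 := by
        push_cast
        linear_combination h1
      exact_mod_cast (mul_eq_zero.1 this).resolve_left (pow_ne_zero 3 hy)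
    · obtain rfl : x = -y := by linear_combination hx
      apply k2
      have : y ^ 3 * ((((1 - τ) * (f 0 * (-1) ^ 3 + f 1 * ((-1) ^ 2 * 1) + f 2 * ((-1) * 1 ^ 2)
        + f 3 * 1 ^ 3) + τ * (f' 0 * (-1) ^ 3 + f' 1 * ((-1) ^ 2 * 1) + f' 2 * ((-1) * 1 ^ 2)
        + f' 3 * 1 ^ 3) : ℝ)) : ℂ) = 0 := by
        push_cast
        linear_combination h1
      exact_mod_cast (mul_eq_zero.1 this).resolve_left (pow_ne_zero 3 hy)
  subst hy
  have k0' : ((1 - τ) * f 0 + τ * f' 0 : ℂ) ≠ 0 := by exact_mod_cast k0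
  refine ⟨?_, rfl⟩
  have : ((1 - τ) * f 0 + τ * f' 0 : ℂ) * x ^ 3 = 0 := by linear_combination h1
  simpa using (mul_eq_zero.1 this).resolve_left k0'

theorem noCommonRoot_shifted_cube {c r : ℝ} (h : c ^ 2 + r ≠ 0) :
    NoCommonRoot ![1, 3 * c, 3 * c ^ 2, c ^ 3] ![0, 1, 0, r] := by
  refine noCommonRoot_of_coords fun x y h1 h2 => ?_
  simp at h1 h2
  have h3 : (x + c * y) ^ 3 = 0 := by linear_combination h1
  have hx : x = -(c * y) := by
    linear_combination pow_eq_zero_iff three_ne_zero |>.1 h3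
  subst hx
  have h' : (c ^ 2 + r : ℂ) ≠ 0 := by exact_mod_cast h
  have : (c ^ 2 + r : ℂ) * y ^ 3 = 0 := by linear_combination h2
  have := (mul_eq_zero.1 this).resolve_left h'
  simp at this
  simp [this]

/-- Letting `r` grow from `-1` to `1` in `s²t + rt³` makes the roots `[±1 : 1]` collide and become
complex. Meanwhile `c² + r` stays positive, so none of them meets the root `[-c : 1]` of `(s +
ct)³`. -/
theorem isStandard_shifted_cube {c : ℝ} (hc : 1 < c ^ 2) :
    IsStandard ![1, 3 * c, 3 * c ^ 2, c ^ 3] ![0, 1, 0, -1] := by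
  refine (isStandard_of_complex_root (noCommonRoot_shifted_cube (c := c) (r := 1) (by linarith))).of_path
    (fun _ => ![1, 3 * c, 3 * c ^ 2, c ^ 3]) (fun τ => ![0, 1, 0, -1 + 2 * τ]) continuous_const
    (continuous_vec (by fun_prop) (by fun_prop) (by fun_prop) (by fun_prop)) ?_ rfl (by simp) rfl
    (by norm_num)
  rintro τ ⟨t0, t1⟩
  exact noCommonRoot_shifted_cube (by linarith)

theorem isStandard_cube_three_real_roots : IsStandard ![1, 0, 0, 0] ![0, 1, 0, -1] := by
  refine (isStandard_cube.of_smul_right (c := -1) (g := ![0, 0, 0, -1]) (by norm_num)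
    (by simp)).of_path (fun _ => ![1, 0, 0, 0]) (fun τ => ![0, 1 - τ, 0, -1])
      continuous_const (continuous_vec (by fun_prop) (by fun_prop) (by fun_prop)
      (by fun_prop)) ?_ rfl (by simp) rfl (by simp)
  intro τ _
  refine noCommonRoot_of_coords fun x y h1 h2 => ?_
  simp at h1 h2
  subst h1
  simpa using h2

/-- A pencil containing a form with three distinct real roots. -/
theorem isStandard_of_three_real_roots {f : Fin 4 → ℝ} (h : NoCommonRoot f ![0, 1, 0, -1]) :
    IsStandard f ![0, 1, 0, -1] := by
  have h0 := h.left_zero_ne rfl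
  have aux : ∀ f : Fin 4 → ℝ, 0 < f 0 → realValue f 1 1 ≠ 0 → realValue f (-1) 1 ≠ 0 →
      IsStandard f ![0, 1, 0, -1] := by
    intro f h0 h1 h2
    -- With `f 0` positive there are four sign patterns at `[1 : 1]`, `[-1 : 1]`, realized in this
    -- order by `(s - 2t)³`, `s³ - 4st²`, `s³`, `(s + 2t)³`. Only the second is the cubic of `K₂`.
    rcases h1.lt_or_gt with h1 | h1 <;> rcases h2.lt_or_gt with h2 | h2
    · refine isStandard_of_same_signs (isStandard_shifted_cube (c := -2) (by norm_num)) ?_ ?_ ?_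
      · simpa using h0
      · refine mul_pos_of_neg_of_neg h1 ?_
        norm_num [realValue_vec]
      · refine mul_pos_of_neg_of_neg h2 ?_
        norm_num [realValue_vec]
    · refine isStandard_of_same_signs isStandard_standard_two ?_ ?_ ?_
      · simpa using h0
      · refine mul_pos_of_neg_of_neg h1 ?_
        norm_num [realValue_vec]
      · refine mul_pos h2 ?_
        norm_num [realValue_vec]
    · refine isStandard_of_same_signs isStandard_cube_three_real_roots ?_ ?_ ?_
      · simpa using h0
      · refine mul_pos h1 ?_
        norm_num [realValue_vec]
      · refine mul_pos_of_neg_of_neg h2 ?_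
        norm_num [realValue_vec]
    · refine isStandard_of_same_signs (isStandard_shifted_cube (c := 2) (by norm_num)) ?_ ?_ ?_
      · simpa using h0
      · refine mul_pos h1 ?_
        norm_num [realValue_vec]
      · refine mul_pos h2 ?_
        norm_num [realValue_vec]
  have h1 := h.realValue_ne (x := 1) (y := 1) (by simp) (by simp [realValue])
  have h2 := h.realValue_ne (x := -1) (y := 1) (by simp) (by simp [realValue])
  rcases h0.lt_or_gt with h0 | h0
  · refine IsStandard.of_smul_left (f' := (-1 : ℝ) • f) (aux _ ?_ ?_ ?_) (by norm_num) rfl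
    · simpa using h0
    · contrapose! h1
      simp [realValue] at h1 ⊢
      linarith
    · contrapose! h2
      simp [realValue] at h2 ⊢
      linarith
  · exact aux f h0 h1 h2

/-! ### Reduction of an arbitrary pencil to the normal forms. -/

theorem NoCommonRoot.smul_right {f g : Fin 4 → ℝ} (h : NoCommonRoot f g) {c : ℝ} (hc : c ≠ 0) :
    NoCommonRoot f (c • g) :=
  h.target 1 0 0 c (by simpa) (by simp) (by simp)

/-- The positive scaling `s ↦ √|r|·s` reduces a nonzero `r` to its sign; `r = 0` is the double root
case. -/
theorem isStandard_of_depressed {f : Fin 4 → ℝ} {r : ℝ} (h : NoCommonRoot f ![0, 1, 0, r]) :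
    IsStandard f ![0, 1, 0, r] := by
  rcases lt_trichotomy r 0 with hr | rfl | hr
  · have hs := Real.sq_sqrt (neg_pos.2 hr).le
    have hs0 := Real.sqrt_pos.2 (neg_pos.2 hr)
    have e : (-1 / r) • substitute √(-r) 0 0 1 ![0, 1, 0, r] = ![0, 1, 0, -1] := by
      ext i
      fin_cases i <;> simp [substitute, hs, neg_div, hr.ne]
    refine IsStandard.of_scaling h hs0 (IsStandard.of_smul_right (c := -1 / r) ?_ (by simp [hr.ne])
      rfl)
    have h' := (h.substitute (α := √(-r)) (β := 0) (γ := 0) (δ := 1)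
      (by simpa using hs0.ne')).smul_right (c := -1 / r) (by simp [hr.ne])
    rw [e] at h' ⊢
    exact isStandard_of_three_real_roots h'
  · exact isStandard_of_double_root h
  · have hs := Real.sq_sqrt hr.le
    have hs0 := Real.sqrt_pos.2 hr
    have e : (1 / r) • substitute √r 0 0 1 ![0, 1, 0, r] = ![0, 1, 0, 1] := by
      ext i
      fin_cases i <;> simp [substitute, hs] <;> field_simp
    refine IsStandard.of_scaling h hs0 (IsStandard.of_smul_right (c := 1 / r) ?_ (by simp [hr.ne'])
      rfl)
    have h' := (h.substitute (α := √r) (β := 0) (γ := 0) (δ := 1)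
      (by simpa using hs0.ne')).smul_right (c := 1 / r) (by simp [hr.ne'])
    rw [e] at h' ⊢
    exact isStandard_of_complex_root h'

theorem isStandard_of_right_zero {f g : Fin 4 → ℝ} (h : NoCommonRoot f g) (hg : g 0 = 0) :
    IsStandard f g := by
  by_cases h1 : g 1 = 0
  · by_cases h2 : g 2 = 0
    · have h3 : g 3 ≠ 0 := by
        intro h3
        obtain ⟨θ, hθ⟩ := exists_realValue_eq_zero f
        refine h.realValue_ne (x := Real.cos θ) (y := Real.sin θ) ?_ ?_ hθ
        · by_contra! h0
          have := Real.sin_sq_add_cos_sq θ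
          simp [h0.1, h0.2] at this
        · simp [realValue, hg, h1, h2, h3]
      have e : (1 / g 3) • g = ![0, 0, 0, 1] := by
        ext i
        fin_cases i <;> simp [hg, h1, h2, h3]
      have h' := h.smul_right (one_div_ne_zero h3)
      refine IsStandard.of_smul_right ?_ (one_div_ne_zero h3) rfl
      rw [e] at h' ⊢
      exact isStandard_of_triple_root h'
    -- Here `g = t²(g₂s + g₃t)`. The shear moves the simple root to `[0 : 1]`, and the quarter turn
    -- then exchanges the two roots, leaving `-g₂s²t`.
    · refine IsStandard.of_shear h (-g 3 / g 2) ?_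
      have h' := h.substitute (α := 1) (β := -g 3 / g 2) (γ := 0) (δ := 1) (by simp)
      refine IsStandard.of_rotation h' (Real.pi / 2) ?_
      rw [Real.cos_pi_div_two, Real.sin_pi_div_two]
      have h'' := (h'.substitute (α := 0) (β := -1) (γ := 1) (δ := 0) (by simp)).smul_right
        (c := -1 / g 2) (by simp [h2])
      refine IsStandard.of_smul_right (c := -1 / g 2) ?_ (by simp [h2]) rfl
      have e : (-1 / g 2) • substitute 0 (-1) 1 0 (substitute 1 (-g 3 / g 2) 0 1 g) =
          ![0, 1, 0, 0] := by
        ext i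
        fin_cases i <;> simp [substitute, hg, h1, h2]
        field_simp
        ring
      rw [e] at h'' ⊢
      exact isStandard_of_double_root h''
  -- Completing the square in the quadratic cofactor of `t`.
  · refine IsStandard.of_shear h (-g 2 / (2 * g 1)) ?_
    have h' := (h.substitute (α := 1) (β := -g 2 / (2 * g 1)) (γ := 0) (δ := 1)
      (by simp)).smul_right (one_div_ne_zero h1)
    refine IsStandard.of_smul_right ?_ (one_div_ne_zero h1) rfl
    have e : (1 / g 1) • substitute 1 (-g 2 / (2 * g 1)) 0 1 g =
        ![0, 1, 0, g 3 / g 1 - g 2 ^ 2 / (4 * g 1 ^ 2)] := by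
      ext i
      fin_cases i <;> simp [substitute, hg, h1] <;> field_simp <;> ring
    rw [e] at h' ⊢
    exact isStandard_of_depressed h'

/-- A rotation moves a real root of `g` to `[1 : 0]`. -/
theorem isStandard_of_noCommonRoot {f g : Fin 4 → ℝ} (h : NoCommonRoot f g) :
    IsStandard f g := by
  obtain ⟨θ, hθ⟩ := exists_realValue_eq_zero g
  refine IsStandard.of_rotation h θ (isStandard_of_right_zero (h.substitute ?_) ?_)
  · have := Real.sin_sq_add_cos_sq θ
    nlinarith
  · simpa [substitute, realValue] using hθ

/-! ### Dehomogenization and factorization through the Segre map. -/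

/-- The substitution `s = X`, `t = 1`. -/
noncomputable def dehomogenize : Form →ₐ[ℝ] Polynomial ℝ :=
  aeval ![Polynomial.X, 1]

/-- The binary quartic form with coefficients `c`. -/
noncomputable def quartic (c : Fin 5 → ℝ) : Form :=
  C (c 4) * X 0 ^ 4 + C (c 3) * (X 0 ^ 3 * X 1) + C (c 2) * (X 0 ^ 2 * X 1 ^ 2) +
    C (c 1) * (X 0 * X 1 ^ 3) + C (c 0) * X 1 ^ 4

/-- The binary quadratic form with coefficients `c`. -/
noncomputable def quadratic (c : Fin 3 → ℝ) : Form :=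
  C (c 2) * X 0 ^ 2 + C (c 1) * (X 0 * X 1) + C (c 0) * X 1 ^ 2

/-- The binary linear form with coefficients `c`. -/
noncomputable def linear (c : Fin 2 → ℝ) : Form :=
  C (c 1) * X 0 + C (c 0) * X 1

theorem exists_eq_quartic {p : Form} (hp : p.IsHomogeneous 4) : ∃ c, p = quartic c := by
  rw [p.as_sum]
  refine Finset.sum_induction _ (fun q : Form => ∃ c, q = quartic c) ?_ ?_ ?_
  · rintro _ _ ⟨c, rfl⟩ ⟨d, rfl⟩
    refine ⟨c + d, ?_⟩
    simp only [quartic, Pi.add_apply, map_add]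
    ring
  · exact ⟨0, by simp [quartic]⟩
  · intro m hm
    have hdeg : m 0 + m 1 = 4 := by
      have := hp.degree_eq_sum_deg_support hm
      rw [← Finsupp.degree_apply, Finsupp.degree_eq_sum, Fin.sum_univ_two] at this
      exact this.symm
    have hmon : monomial m (coeff m p) = C (coeff m p) * (X 0 ^ m 0 * X 1 ^ m 1) := by
      rw [monomial_eq, Finsupp.prod_fintype _ _ (by simp), Fin.prod_univ_two]
    rw [hmon]
    have h1 : m 1 = 4 - m 0 := by omega
    have h0 : m 0 ≤ 4 := by omega
    rw [h1]
    interval_cases h : m 0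
    · exact ⟨![coeff m p, 0, 0, 0, 0], by simp [quartic]⟩
    · exact ⟨![0, coeff m p, 0, 0, 0], by simp [quartic]⟩
    · exact ⟨![0, 0, coeff m p, 0, 0], by simp [quartic]⟩
    · exact ⟨![0, 0, 0, coeff m p, 0], by simp [quartic]⟩
    · exact ⟨![0, 0, 0, 0, coeff m p], by simp [quartic]⟩

theorem dehomogenize_quartic (c : Fin 5 → ℝ) : dehomogenize (quartic c) =
    Polynomial.C (c 4) * Polynomial.X ^ 4 + Polynomial.C (c 3) * Polynomial.X ^ 3 +
    Polynomial.C (c 2) * Polynomial.X ^ 2 + Polynomial.C (c 1) * Polynomial.X +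
    Polynomial.C (c 0) := by
  simp [dehomogenize, quartic, Polynomial.C_eq_algebraMap]

theorem natDegree_dehomogenize_le {p : Form} (hp : p.IsHomogeneous 4) :
    (dehomogenize p).natDegree ≤ 4 := by
  obtain ⟨c, rfl⟩ := exists_eq_quartic hp
  rw [dehomogenize_quartic]
  compute_degree

theorem eq_of_dehomogenize_eq {p q : Form} (hp : p.IsHomogeneous 4) (hq : q.IsHomogeneous 4)
    (h : dehomogenize p = dehomogenize q) : p = q := by
  obtain ⟨c, rfl⟩ := exists_eq_quartic hp
  obtain ⟨d, rfl⟩ := exists_eq_quartic hq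
  rw [dehomogenize_quartic, dehomogenize_quartic] at h
  congr 1
  ext i
  have := congrArg (fun r => Polynomial.coeff r i) h
  fin_cases i <;>
    simpa [Polynomial.coeff_X, Polynomial.coeff_C, Polynomial.coeff_X_pow] using this

/-- Since `x` divides `yz`, it splits as a divisor of `y` times a divisor of `z`. Applied to
dehomogenized coordinates, this uses factorization in one variable and avoids showing that factors
of forms are forms. -/
theorem exists_segre_factorization {R : Type*} [CommRing R] [IsDomain R] [DecompositionMonoid R]
    {x y z w : R} (h : x * w = y * z) :
    ∃ a b c d : R, x = a * b ∧ y = a * c ∧ z = d * b ∧ w = d * c := by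
  by_cases hx : x = 0
  · rw [hx, zero_mul, eq_comm, mul_eq_zero] at h
    rcases h with h | h
    · exact ⟨0, z, w, 1, by simp [hx, h]⟩
    · exact ⟨y, 0, 1, w, by simp [hx, h]⟩
  · obtain ⟨a, b, ⟨c, hc⟩, ⟨d, hd⟩, rfl⟩ := exists_dvd_and_dvd_of_dvd_mul (Dvd.intro w h)
    refine ⟨a, b, c, d, rfl, hc, by rw [hd, mul_comm], mul_left_cancel₀ hx ?_⟩
    rw [h, hc, hd]
    ring

theorem exists_max_natDegree {p q : Polynomial ℝ} (h : p ≠ 0 ∨ q ≠ 0) :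
    ∃ x, (x = p ∨ x = q) ∧ x ≠ 0 ∧ p.natDegree ≤ x.natDegree ∧ q.natDegree ≤ x.natDegree := by
  by_cases hp : p = 0
  · exact ⟨q, Or.inr rfl, by simpa [hp] using h, by simp [hp], le_rfl⟩
  by_cases hq : q = 0
  · exact ⟨p, Or.inl rfl, hp, le_rfl, by simp [hq]⟩
  rcases le_total p.natDegree q.natDegree with h | h
  · exact ⟨q, Or.inr rfl, hq, h, le_rfl⟩
  · exact ⟨p, Or.inl rfl, hp, le_rfl, h⟩

theorem exists_dehomogenize_linear {p : Polynomial ℝ} (h : p.natDegree ≤ 1) :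
    ∃ c, p = dehomogenize (linear c) := by
  refine ⟨fun i => p.coeff i, ?_⟩
  conv_lhs => rw [p.as_sum_range_C_mul_X_pow' (Nat.lt_succ_of_le h)]
  simp [dehomogenize, linear, Polynomial.C_eq_algebraMap, Finset.sum_range_succ]
  ring

theorem exists_dehomogenize_quadratic {p : Polynomial ℝ} (h : p.natDegree ≤ 2) :
    ∃ c, p = dehomogenize (quadratic c) := by
  refine ⟨fun i => p.coeff i, ?_⟩
  conv_lhs => rw [p.as_sum_range_C_mul_X_pow' (Nat.lt_succ_of_le h)]
  simp [dehomogenize, quadratic, Polynomial.C_eq_algebraMap, Finset.sum_range_succ]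
  ring

theorem exists_dehomogenize_cubic {p : Polynomial ℝ} (h : p.natDegree ≤ 3) :
    ∃ c, p = dehomogenize (cubic c) := by
  refine ⟨![p.coeff 3, p.coeff 2, p.coeff 1, p.coeff 0], ?_⟩
  conv_lhs => rw [p.as_sum_range_C_mul_X_pow' (Nat.lt_succ_of_le h)]
  simp [dehomogenize, cubic, Polynomial.C_eq_algebraMap, Finset.sum_range_succ]
  ring

theorem exists_dehomogenize_quartic {p : Polynomial ℝ} (h : p.natDegree ≤ 4) :
    ∃ c, p = dehomogenize (quartic c) := by
  refine ⟨fun i => p.coeff i, ?_⟩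
  conv_lhs => rw [p.as_sum_range_C_mul_X_pow' (Nat.lt_succ_of_le h)]
  simp [dehomogenize, quartic, Polynomial.C_eq_algebraMap, Finset.sum_range_succ]
  ring

theorem linear_isHomogeneous (c : Fin 2 → ℝ) : (linear c).IsHomogeneous 1 :=
  ((isHomogeneous_X _ _).C_mul _).add ((isHomogeneous_X _ _).C_mul _)

theorem quadratic_isHomogeneous (c : Fin 3 → ℝ) : (quadratic c).IsHomogeneous 2 := by
  have h0 : (X 0 : Form).IsHomogeneous 1 := isHomogeneous_X _ _
  have h1 : (X 1 : Form).IsHomogeneous 1 := isHomogeneous_X _ _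
  exact (((h0.pow 2).C_mul _).add ((h0.mul h1).C_mul _)).add ((h1.pow 2).C_mul _)

theorem quartic_isHomogeneous (c : Fin 5 → ℝ) : (quartic c).IsHomogeneous 4 := by
  have h0 : (X 0 : Form).IsHomogeneous 1 := isHomogeneous_X _ _
  have h1 : (X 1 : Form).IsHomogeneous 1 := isHomogeneous_X _ _
  exact (((((h0.pow 4).C_mul _).add (((h0.pow 3).mul h1).C_mul _)).add
    (((h0.pow 2).mul (h1.pow 2)).C_mul _)).add ((h0.mul (h1.pow 3)).C_mul _)).add
    ((h1.pow 4).C_mul _)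

theorem eq_segre_of_dehomogenize {k : Fin 4 → Form} (hk : ∀ i, (k i).IsHomogeneous 4)
    {m n : ℕ} (hmn : m + n = 4) {a b c d : Form} (ha : a.IsHomogeneous m) (hd : d.IsHomogeneous m)
    (hb : b.IsHomogeneous n) (hc : c.IsHomogeneous n)
    (h0 : dehomogenize (k 0) = dehomogenize a * dehomogenize b)
    (h1 : dehomogenize (k 1) = dehomogenize a * dehomogenize c)
    (h2 : dehomogenize (k 2) = dehomogenize d * dehomogenize b)
    (h3 : dehomogenize (k 3) = dehomogenize d * dehomogenize c) :
    k = segre ![a, d] ![b, c] := by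
  have hmul : ∀ {x y : Form}, x.IsHomogeneous m → y.IsHomogeneous n →
      (x * y).IsHomogeneous 4 := fun hx hy => by
    have := hx.mul hy
    rwa [hmn] at this
  ext1 i
  fin_cases i <;> refine eq_of_dehomogenize_eq (hk _) ?_ ?_
  · exact hmul ha hb
  · simpa [segre] using h0
  · exact hmul ha hc
  · simpa [segre] using h1
  · exact hmul hd hb
  · simpa [segre] using h2
  · exact hmul hd hc
  · simpa [segre] using h3

/-! ### Exclusion of the bi-degrees (0, 4) and (2, 2). -/

theorem value_segre (a b c d : Form) (v : Fin 2 → ℂ) : value (segre ![a, d] ![b, c]) v =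
    ![aeval v a * aeval v b, aeval v a * aeval v c, aeval v d * aeval v b,
      aeval v d * aeval v c] := by
  ext i
  fin_cases i <;> simp [value, segre]

theorem partialValue_segre (a b c d : Form) (j : Fin 2) (v : Fin 2 → ℂ) :
    partialValue (segre ![a, d] ![b, c]) j v =
      ![aeval v a * aeval v (pderiv j b) + aeval v b * aeval v (pderiv j a),
        aeval v a * aeval v (pderiv j c) + aeval v c * aeval v (pderiv j a),
        aeval v d * aeval v (pderiv j b) + aeval v b * aeval v (pderiv j d),
        aeval v d * aeval v (pderiv j c) + aeval v c * aeval v (pderiv j d)] := by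
  ext i
  fin_cases i <;> simp [partialValue, segre, Derivation.leibniz]

theorem exists_smul_of_cross_eq {u₁ u₂ v₁ v₂ : ℂ} (hu : u₁ ≠ 0 ∨ u₂ ≠ 0)
    (h : v₁ * u₂ = v₂ * u₁) : ∃ l : ℂ, v₁ = l * u₁ ∧ v₂ = l * u₂ := by
  rcases hu with hu | hu
  · refine ⟨v₁ / u₁, by field_simp, ?_⟩
    field_simp
    linear_combination -h
  · refine ⟨v₂ / u₂, ?_, by field_simp⟩
    field_simp
    linear_combination h

theorem IsKnotParametrization.not_proportional {d : ℕ} {k : Fin 4 → Form}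
    (hk : IsKnotParametrization d k) {v : Fin 2 → ℂ} (hv : v ≠ 0) (α β : ℂ)
    (h0 : partialValue k 0 v = α • value k v) (h1 : partialValue k 1 v = β • value k v) :
    False := by
  have h := LinearIndependent.pair_iff.1 (hk.immersion v hv)
  have e := h β (-α) (by rw [h0, h1, smul_smul, smul_smul, ← add_smul]; ring_nf; simp)
  have := h 1 0 (by rw [h0, neg_eq_zero.1 e.2]; simp)
  exact one_ne_zero this.1

theorem exists_quadratic_root (e₂ e₁ e₀ : ℂ) :
    ∃ x y : ℂ, (x ≠ 0 ∨ y ≠ 0) ∧ e₂ * x ^ 2 + e₁ * (x * y) + e₀ * y ^ 2 = 0 := by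
  by_cases h : e₂ = 0
  · exact ⟨1, 0, by simp, by simp [h]⟩
  · obtain ⟨s, hs⟩ := IsAlgClosed.exists_pow_nat_eq (e₁ ^ 2 - 4 * e₂ * e₀) two_pos
    refine ⟨(-e₁ + s) / (2 * e₂), 1, by simp, ?_⟩
    field_simp
    linear_combination hs

theorem exists_cubic_root {e₃ : ℂ} (e₂ e₁ e₀ : ℂ) (h : e₃ ≠ 0) :
    ∃ x : ℂ, e₃ * x ^ 3 + e₂ * x ^ 2 + e₁ * x + e₀ = 0 := by
  obtain ⟨x, hx⟩ := IsAlgClosed.exists_root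
    (Polynomial.C e₃ * Polynomial.X ^ 3 + Polynomial.C e₂ * Polynomial.X ^ 2 +
      Polynomial.C e₁ * Polynomial.X + Polynomial.C e₀) (by
      rw [Polynomial.degree_cubic h]
      norm_num)
  exact ⟨x, by simpa [Polynomial.IsRoot] using hx⟩

theorem exists_kernel_vector {p q p' q' : ℂ} (h : p * q' = q * p') :
    ∃ x y : ℂ, (x ≠ 0 ∨ y ≠ 0) ∧ p * x + q * y = 0 ∧ p' * x + q' * y = 0 := by
  by_cases h1 : p ≠ 0 ∨ q ≠ 0
  · refine ⟨q, -p, ?_, by ring, by linear_combination -h⟩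
    simpa [or_comm] using h1
  · push Not at h1
    by_cases h2 : p' ≠ 0 ∨ q' ≠ 0
    · refine ⟨q', -p', ?_, by simp [h1], by ring⟩
      simpa [or_comm] using h2
    · push Not at h2
      exact ⟨1, 0, by simp, by simp [h1], by simp [h2]⟩

theorem segre_linear_cubic {l l' : Fin 2 → ℝ} {f g : Fin 4 → ℝ}
    (hk : IsKnotParametrization 4 (segre ![linear l, linear l'] ![cubic f, cubic g])) :
    ∃ B : Matrix (Fin 4) (Fin 4) ℝ, B.det ≠ 0 ∧ NoCommonRoot f g ∧
      segre ![linear l, linear l'] ![cubic f, cubic g] = transform B (twisted f g) := by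
  -- The Kronecker product of the coefficient matrix of `l, l'` with the `2 × 2` identity; if it
  -- were singular, the two linear forms would have a common root.
  refine ⟨!![l 1, 0, l 0, 0; 0, l 1, 0, l 0; l' 1, 0, l' 0, 0; 0, l' 1, 0, l' 0], ?_, ?_, ?_⟩
  · have e : Matrix.det !![l 1, 0, l 0, 0; 0, l 1, 0, l 0; l' 1, 0, l' 0, 0; 0, l' 1, 0, l' 0] =
        (l 1 * l' 0 - l 0 * l' 1) ^ 2 := by
      simp [Matrix.det_succ_row_zero, Fin.sum_univ_succ, Fin.succAbove]
      ring
    rw [e]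
    refine pow_ne_zero 2 fun h => ?_
    have h' : (l 1 * l' 0 : ℂ) = l 0 * l' 1 := by exact_mod_cast sub_eq_zero.1 h
    obtain ⟨x, y, hxy, e1, e2⟩ := exists_kernel_vector h'
    refine hk.no_common_root ![x, y] (fun h0 => ?_) ?_
    · have := congrFun h0 0
      have := congrFun h0 1
      simp_all
    · rw [value_segre]
      simp [linear, e1, e2]
  · intro v hv hf hg
    refine hk.no_common_root v hv ?_
    rw [value_segre]
    simp [aeval_cubic, hf, hg]
  · ext1 i
    fin_cases i <;>
      simp [transform, twisted, segre, Fin.sum_univ_four, linear] <;> ring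

theorem not_isKnotParametrization_segre_const_quartic {r r' : ℝ} {b c : Fin 5 → ℝ}
    (hk : IsKnotParametrization 4 (segre ![C r, C r'] ![quartic b, quartic c])) : False := by
  have hv : (![1, 0] : Fin 2 → ℂ) ≠ 0 := fun h => one_ne_zero (congrFun h 0)
  have hbc : (b 4 : ℂ) ≠ 0 ∨ (c 4 : ℂ) ≠ 0 := by
    by_contra! h
    refine hk.no_common_root _ hv ?_
    rw [value_segre]
    simp [quartic, h.1, h.2]
  -- Consider the fibre of `[b : c]` through `[1 : 0]`. Removing this point from it leaves a cubic
  -- with this leading coefficient. If it is zero, the map is ramified at `[1 : 0]`; otherwise the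
  -- cubic has a root `x` and `[x : 1]` is a second point of the fibre.
  by_cases h3 : (b 4 * c 3 - c 4 * b 3 : ℂ) = 0
  · obtain ⟨μ, h1, h2⟩ := exists_smul_of_cross_eq hbc
      (show (b 3 : ℂ) * c 4 = c 3 * b 4 by linear_combination -h3)
    refine hk.not_proportional hv 4 μ ?_ ?_
    · rw [value_segre, partialValue_segre]
      ext i
      fin_cases i <;> simp [quartic, Derivation.leibniz, pderiv_X] <;> ring
    · rw [value_segre, partialValue_segre]
      ext i
      fin_cases i <;> simp [quartic, Derivation.leibniz, pderiv_X, h1, h2] <;> ring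
  · obtain ⟨x, hx⟩ := exists_cubic_root (b 4 * c 2 - c 4 * b 2 : ℂ) (b 4 * c 1 - c 4 * b 1)
      (b 4 * c 0 - c 4 * b 0) h3
    have hw : (![x, 1] : Fin 2 → ℂ) ≠ 0 := fun h => one_ne_zero (congrFun h 1)
    obtain ⟨μ, h1, h2⟩ := exists_smul_of_cross_eq hbc
      (show aeval ![x, 1] (quartic b) * (c 4 : ℂ) = aeval ![x, 1] (quartic c) * b 4 by
        simp [quartic]
        linear_combination -hx)
    obtain ⟨z, hz⟩ := hk.no_double_point _ _ hw hv ⟨μ, by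
      rw [value_segre, value_segre]
      ext i
      fin_cases i <;> simp [h1, h2] <;> simp [quartic] <;> ring⟩
    simpa using congrFun hz 1

theorem aeval_quadratic (a : Fin 3 → ℝ) (v : Fin 2 → ℂ) :
    aeval v (quadratic a) = a 2 * v 0 ^ 2 + a 1 * (v 0 * v 1) + a 0 * v 1 ^ 2 := by
  simp [quadratic]

theorem aeval_pderiv_zero_quadratic (a : Fin 3 → ℝ) (v : Fin 2 → ℂ) :
    aeval v (pderiv 0 (quadratic a)) = 2 * a 2 * v 0 + a 1 * v 1 := by
  simp [quadratic, Derivation.leibniz, pderiv_X]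
  ring

theorem aeval_pderiv_one_quadratic (a : Fin 3 → ℝ) (v : Fin 2 → ℂ) :
    aeval v (pderiv 1 (quadratic a)) = a 1 * v 0 + 2 * a 0 * v 1 := by
  simp [quadratic, Derivation.leibniz, pderiv_X]
  ring

/-- If the Wronskian of two quadratic forms vanishes at `v`, then so does the differential of the
quotient of the two forms. -/
theorem exists_smul_pderiv_quadratic {a d : Fin 3 → ℝ} {v : Fin 2 → ℂ}
    (hv : aeval v (quadratic a) ≠ 0 ∨ aeval v (quadratic d) ≠ 0)
    (h : ((a 2 * d 1 - a 1 * d 2) * v 0 ^ 2 + 2 * (a 2 * d 0 - a 0 * d 2) * (v 0 * v 1) +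
      (a 1 * d 0 - a 0 * d 1) * v 1 ^ 2 : ℂ) = 0) (j : Fin 2) :
    ∃ l : ℂ, aeval v (pderiv j (quadratic a)) = l * aeval v (quadratic a) ∧
      aeval v (pderiv j (quadratic d)) = l * aeval v (quadratic d) := by
  refine exists_smul_of_cross_eq hv ?_
  revert j
  rw [Fin.forall_fin_two, aeval_pderiv_zero_quadratic, aeval_pderiv_zero_quadratic,
    aeval_pderiv_one_quadratic, aeval_pderiv_one_quadratic, aeval_quadratic, aeval_quadratic]
  constructor
  · linear_combination v 1 * h
  · linear_combination -v 0 * h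

theorem not_isKnotParametrization_segre_quadratic {a b c d : Fin 3 → ℝ}
    (hk : IsKnotParametrization 4
      (segre ![quadratic a, quadratic d] ![quadratic b, quadratic c])) : False := by
  have hne : ∀ v : Fin 2 → ℂ, v ≠ 0 →
      (aeval v (quadratic a) ≠ 0 ∨ aeval v (quadratic d) ≠ 0) ∧
      (aeval v (quadratic b) ≠ 0 ∨ aeval v (quadratic c) ≠ 0) := by
    intro v hv
    have := hk.no_common_root v hv
    rw [value_segre] at this
    constructor
    · by_contra! h
      exact this (by simp [h.1, h.2])
    · by_contra! h
      exact this (by simp [h.1, h.2])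
  -- Coefficients of the symmetric bilinear forms `A`, `B` with `a(v)d(v') - d(v)a(v') = (xy' -
  -- yx')·A(v, v')`, and likewise `B` for `b, c`. Thus `A` relates the two points of each fibre of
  -- `[a : d]`.
  let A2 : ℂ := a 2 * d 1 - a 1 * d 2
  let A1 : ℂ := a 2 * d 0 - a 0 * d 2
  let A0 : ℂ := a 1 * d 0 - a 0 * d 1
  let B2 : ℂ := b 2 * c 1 - b 1 * c 2
  let B1 : ℂ := b 2 * c 0 - b 0 * c 2
  let B0 : ℂ := b 1 * c 0 - b 0 * c 1
  -- The linear forms `A(v, ·)` and `B(v, ·)` are dependent exactly where a quadratic form in `v`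
  -- vanishes. A complex root `v` and a common kernel vector `v'` then have the same image under
  -- both components.
  obtain ⟨x, y, hxy, hdet⟩ := exists_quadratic_root (A2 * B1 - A1 * B2) (A2 * B0 - A0 * B2)
    (A1 * B0 - A0 * B1)
  obtain ⟨x', y', hxy', hA, hB⟩ := exists_kernel_vector
    (show (A2 * x + A1 * y) * (B1 * x + B0 * y) = (A1 * x + A0 * y) * (B2 * x + B1 * y) by
      linear_combination hdet)
  have hv : ∀ {x y : ℂ}, (x ≠ 0 ∨ y ≠ 0) → (![x, y] : Fin 2 → ℂ) ≠ 0 := by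
    intro x y h h0
    have e0 := congrFun h0 0
    have e1 := congrFun h0 1
    simp at e0 e1
    simp [e0, e1] at h
  have hv1 := hv hxy
  have hv2 := hv hxy'
  simp only [A2, A1, A0, B2, B1, B0] at hA hB
  obtain ⟨l, l1, l2⟩ := exists_smul_of_cross_eq (hne _ hv2).1
    (show aeval ![x, y] (quadratic a) * aeval ![x', y'] (quadratic d) =
        aeval ![x, y] (quadratic d) * aeval ![x', y'] (quadratic a) by
      simp only [aeval_quadratic]
      simp
      linear_combination (x * y' - y * x') * hA)
  obtain ⟨m, m1, m2⟩ := exists_smul_of_cross_eq (hne _ hv2).2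
    (show aeval ![x, y] (quadratic b) * aeval ![x', y'] (quadratic c) =
        aeval ![x, y] (quadratic c) * aeval ![x', y'] (quadratic b) by
      simp only [aeval_quadratic]
      simp
      linear_combination (x * y' - y * x') * hB)
  obtain ⟨z, hz⟩ := hk.no_double_point _ _ hv1 hv2 ⟨l * m, by
    rw [value_segre, value_segre]
    ext i
    fin_cases i <;> simp [l1, l2, m1, m2] <;> ring⟩
  have hx : x = z * x' := by simpa using congrFun hz 0
  have hy : y = z * y' := by simpa using congrFun hz 1
  have hz0 : z ≠ 0 := by
    rintro rfl
    simp [hx, hy] at hxy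
  -- Absence of double points forces `v` and `v'` to coincide projectively. Now `A` and `B` vanish
  -- on the diagonal, so both Wronskians vanish at `v'` and the differential is zero there.
  subst hx hy
  have jA := exists_smul_pderiv_quadratic (hne _ hv2).1 (by
    refine (mul_eq_zero.1 (?_ : z * _ = 0)).resolve_left hz0
    simp only [Matrix.cons_val_zero, Matrix.cons_val_one]
    linear_combination hA)
  have jB := exists_smul_pderiv_quadratic (hne _ hv2).2 (by
    refine (mul_eq_zero.1 (?_ : z * _ = 0)).resolve_left hz0
    simp only [Matrix.cons_val_zero, Matrix.cons_val_one]
    linear_combination hB)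
  have hj : ∀ j, ∃ s : ℂ, partialValue (segre ![quadratic a, quadratic d]
      ![quadratic b, quadratic c]) j ![x', y'] = s • value (segre ![quadratic a, quadratic d]
      ![quadratic b, quadratic c]) ![x', y'] := by
    intro j
    obtain ⟨s, s1, s2⟩ := jA j
    obtain ⟨t, t1, t2⟩ := jB j
    refine ⟨s + t, ?_⟩
    rw [partialValue_segre, value_segre, s1, s2, t1, t2]
    ext i
    fin_cases i <;> simp <;> ring
  obtain ⟨s, hs⟩ := hj 0
  obtain ⟨t, ht⟩ := hj 1
  exact hk.not_proportional hv2 s t hs ht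

/-! ### Rational quartic knots on a hyperboloid. -/

theorem exists_eq_transform_twisted_of_natDegree_le {k : Fin 4 → Form}
    (hk : IsKnotParametrization 4 k) {a b c d : Polynomial ℝ} {m : ℕ} (hm : m ≤ 2)
    (h0 : dehomogenize (k 0) = a * b) (h1 : dehomogenize (k 1) = a * c)
    (h2 : dehomogenize (k 2) = d * b) (h3 : dehomogenize (k 3) = d * c)
    (ha : a.natDegree ≤ m) (hd : d.natDegree ≤ m) (hb : b.natDegree ≤ 4 - m)
    (hc : c.natDegree ≤ 4 - m) :
    ∃ (B : Matrix (Fin 4) (Fin 4) ℝ) (f g : Fin 4 → ℝ), B.det ≠ 0 ∧ NoCommonRoot f g ∧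
      k = transform B (twisted f g) := by
  interval_cases m
  · have hC : ∀ r : ℝ, Polynomial.C r = dehomogenize (C r) := fun r => by
      simp [dehomogenize, Polynomial.C_eq_algebraMap]
    rw [Polynomial.eq_C_of_natDegree_le_zero ha, hC] at h0 h1
    rw [Polynomial.eq_C_of_natDegree_le_zero hd, hC] at h2 h3
    obtain ⟨b, rfl⟩ := exists_dehomogenize_quartic hb
    obtain ⟨c, rfl⟩ := exists_dehomogenize_quartic hc
    have e := eq_segre_of_dehomogenize hk.homogeneous rfl (isHomogeneous_C _ _)
      (isHomogeneous_C _ _) (quartic_isHomogeneous b) (quartic_isHomogeneous c) h0 h1 h2 h3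
    rw [e] at hk
    exact (not_isKnotParametrization_segre_const_quartic hk).elim
  · obtain ⟨a, rfl⟩ := exists_dehomogenize_linear ha
    obtain ⟨d, rfl⟩ := exists_dehomogenize_linear hd
    obtain ⟨b, rfl⟩ := exists_dehomogenize_cubic hb
    obtain ⟨c, rfl⟩ := exists_dehomogenize_cubic hc
    have e := eq_segre_of_dehomogenize hk.homogeneous rfl (linear_isHomogeneous a)
      (linear_isHomogeneous d) (cubic_isHomogeneous b) (cubic_isHomogeneous c) h0 h1 h2 h3
    rw [e] at hk ⊢
    obtain ⟨B, hB, hbc, h⟩ := segre_linear_cubic hk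
    exact ⟨B, b, c, hB, hbc, h⟩
  · obtain ⟨a, rfl⟩ := exists_dehomogenize_quadratic ha
    obtain ⟨d, rfl⟩ := exists_dehomogenize_quadratic hd
    obtain ⟨b, rfl⟩ := exists_dehomogenize_quadratic hb
    obtain ⟨c, rfl⟩ := exists_dehomogenize_quadratic hc
    have e := eq_segre_of_dehomogenize hk.homogeneous rfl (quadratic_isHomogeneous a)
      (quadratic_isHomogeneous d) (quadratic_isHomogeneous b) (quadratic_isHomogeneous c)
      h0 h1 h2 h3
    rw [e] at hk
    exact (not_isKnotParametrization_segre_quadratic hk).elim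

theorem transform_reflectionMatrix (k : Fin 4 → Form) :
    transform reflectionMatrix k = ![k 0, k 2, k 1, k 3] := by
  ext1 i
  fin_cases i <;> simp [transform, reflectionMatrix, Matrix.GeneralLinearGroup.mkOfDetNeZero,
    Fin.sum_univ_four]

/-- Every rational quartic knot on the standard hyperboloid has bi-degree `(1, 3)` or `(3, 1)`. -/
theorem exists_eq_transform_twisted {k : Fin 4 → Form} (hk : IsKnotParametrization 4 k)
    (h : k 0 * k 3 = k 1 * k 2) :
    ∃ (B : Matrix (Fin 4) (Fin 4) ℝ) (f g : Fin 4 → ℝ), B.det ≠ 0 ∧ NoCommonRoot f g ∧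
      k = transform B (twisted f g) := by
  obtain ⟨a, b, c, d, h0, h1, h2, h3⟩ := exists_segre_factorization
    (show dehomogenize (k 0) * dehomogenize (k 3) = dehomogenize (k 1) * dehomogenize (k 2) by
      rw [← map_mul, h, map_mul])
  have hz : ¬ ∀ i, dehomogenize (k i) = 0 := by
    intro hz
    have hk0 : ∀ i, k i = 0 := fun i =>
      eq_of_dehomogenize_eq (hk.homogeneous i) (isHomogeneous_zero _ _ _) (by rw [hz i, map_zero])
    refine hk.no_common_root ![1, 0] (fun h => one_ne_zero (congrFun h 0)) ?_
    ext i
    simp [value, hk0]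
  have had : a ≠ 0 ∨ d ≠ 0 := by
    by_contra! h
    exact hz fun i => by fin_cases i <;> simp [h0, h1, h2, h3, h.1, h.2]
  have hbc : b ≠ 0 ∨ c ≠ 0 := by
    by_contra! h
    exact hz fun i => by fin_cases i <;> simp [h0, h1, h2, h3, h.1, h.2]
  obtain ⟨x, hx, hx0, hxa, hxd⟩ := exists_max_natDegree had
  obtain ⟨y, hy, hy0, hyb, hyc⟩ := exists_max_natDegree hbc
  -- The product of the two factors of largest degree is itself one of the four coordinates. Hence
  -- the pairs can be homogenized in complementary degrees.
  have hxy : x.natDegree + y.natDegree ≤ 4 := by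
    rw [← Polynomial.natDegree_mul hx0 hy0]
    have hdeg := fun i => natDegree_dehomogenize_le (hk.homogeneous i)
    rcases hx with rfl | rfl <;> rcases hy with rfl | rfl
    · exact h0 ▸ hdeg 0
    · exact h1 ▸ hdeg 1
    · exact h2 ▸ hdeg 2
    · exact h3 ▸ hdeg 3
  rcases le_or_gt x.natDegree 2 with hm | hm
  · exact exists_eq_transform_twisted_of_natDegree_le hk hm h0 h1 h2 h3 hxa hxd (by omega)
      (by omega)
  -- The reflection exchanges the two Segre factors, which brings the first degree down to at most
  -- `2`.
  · have hR : (reflectionMatrix : Matrix (Fin 4) (Fin 4) ℝ).det ≠ 0 := by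
      rw [det_reflectionMatrix]
      norm_num
    obtain ⟨B, f, g, hB, hfg, e⟩ := exists_eq_transform_twisted_of_natDegree_le
      (hk.transform hR) (a := b) (b := a) (c := d) (d := c) (m := 4 - x.natDegree) (by omega)
      (by rw [transform_reflectionMatrix, mul_comm]; exact h0)
      (by rw [transform_reflectionMatrix, mul_comm]; exact h2)
      (by rw [transform_reflectionMatrix, mul_comm]; exact h1)
      (by rw [transform_reflectionMatrix, mul_comm]; exact h3)
      (by omega) (by omega) (by omega) (by omega)
    refine ⟨reflectionMatrix * B, f, g, ?_, hfg, ?_⟩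
    · rw [Matrix.det_mul]
      exact mul_ne_zero hR hB
    · rw [← transform_transform, ← e, transform_transform, reflectionMatrix_mul_self,
        transform_one]

/-- A real polynomial identity may be tested at real vectors, and each nonzero one gives a point of
the curve; the scalar relating it to the chosen representative enters only as a square. -/
theorem mul_eq_mul_of_subset_stdHyperboloid {k : Fin 4 → Form}
    (hk : IsKnotParametrization 4 k) (h : complexPoints k ⊆ stdHyperboloid) :
    k 0 * k 3 = k 1 * k 2 := by
  refine MvPolynomial.funext fun v => ?_
  by_cases hv : v = 0
  · have h0 : ∀ i, eval v (k i) = 0 := by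
      intro i
      obtain ⟨c, hc⟩ := exists_eq_quartic (hk.homogeneous i)
      simp [hc, hv, quartic]
    simp [h0]
  · have hv' : (fun i => (v i : ℂ)) ≠ 0 := fun h0 => hv (by
      ext i
      simpa using congrFun h0 i)
    have hne := hk.no_common_root _ hv'
    have hP : Projectivization.mk ℂ _ hne ∈ stdHyperboloid := h ⟨_, hv', hne, rfl⟩
    obtain ⟨u, hu⟩ := Projectivization.exists_smul_eq_mk_rep ℂ _ hne
    have hval : ∀ i, value k (fun i => (v i : ℂ)) i = (eval v (k i) : ℝ) := fun i => by
      have := aeval_algebraMap_apply ℂ v (k i)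
      simpa [value, Function.comp_def, coe_aeval_eq_eval] using this
    simp only [stdHyperboloid, Set.mem_ofPred_eq, ← hu, Units.smul_def, Pi.smul_apply, smul_eq_mul,
      hval] at hP
    have hu0 : (u : ℂ) ≠ 0 := u.ne_zero
    have e : (((eval v (k 0) * eval v (k 3) - eval v (k 1) * eval v (k 2) : ℝ)) : ℂ) = 0 := by
      refine (mul_eq_zero.1 (?_ : (u : ℂ) ^ 2 * _ = 0)).resolve_left (pow_ne_zero 2 hu0)
      push_cast
      linear_combination hP
    rw [map_mul, map_mul]
    exact sub_eq_zero.1 (by exact_mod_cast e)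

theorem projTransform_mul_apply (A B : GL (Fin 4) ℝ) (P : CP3) :
    projTransform A (projTransform B P) = projTransform (A * B) P := by
  induction P using Projectivization.ind with
  | h v hv =>
    simp only [projTransform, Projectivization.map_mk]
    congr 1
    rw [← LinearMap.comp_apply, ← Matrix.toLin'_mul, Units.val_mul]
    congr 2
    exact (Matrix.map_mul (f := Complex.ofRealHom)).symm

theorem projTransform_one_apply (P : CP3) : projTransform 1 P = P := by
  induction P using Projectivization.ind with
  | h v hv =>
    simp only [projTransform, Projectivization.map_mk]
    congr 1
    have : (1 : Matrix (Fin 4) (Fin 4) ℝ).map Complex.ofReal = 1 :=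
      Matrix.map_one _ Complex.ofReal_zero Complex.ofReal_one
    rw [Units.val_one, this, Matrix.toLin'_one, LinearMap.id_apply]

theorem exists_eq_transform_twisted_of_subset_hyperboloid {k : Fin 4 → Form}
    (hk : IsKnotParametrization 4 k) {X : Set CP3} (hX : IsHyperboloid X)
    (h : complexPoints k ⊆ X) :
    ∃ (B : Matrix (Fin 4) (Fin 4) ℝ) (f g : Fin 4 → ℝ), B.det ≠ 0 ∧ NoCommonRoot f g ∧
      k = transform B (twisted f g) := by
  obtain ⟨A, rfl⟩ := hX
  have hA : ∀ A : GL (Fin 4) ℝ, (A : Matrix (Fin 4) (Fin 4) ℝ).det ≠ 0 := fun A =>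
    ((Matrix.isUnit_iff_isUnit_det _).1 A.isUnit).ne_zero
  have hk' := hk.transform (hA A⁻¹)
  have hsub : complexPoints (transform (A⁻¹ : GL (Fin 4) ℝ) k) ⊆ stdHyperboloid := by
    rw [complexPoints_transform]
    rintro _ ⟨P, hP, rfl⟩
    obtain ⟨Q, hQ, rfl⟩ := h hP
    rwa [projTransform_mul_apply, inv_mul_cancel, projTransform_one_apply]
  obtain ⟨B, f, g, hB, hfg, e⟩ :=
    exists_eq_transform_twisted hk' (mul_eq_mul_of_subset_stdHyperboloid hk' hsub)
  refine ⟨A * B, f, g, ?_, hfg, ?_⟩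
  · rw [Matrix.det_mul]
    exact mul_ne_zero (hA A) hB
  · rw [← transform_transform, ← e, transform_transform, ← Units.val_mul, mul_inv_cancel,
      Units.val_one, transform_one]

/-! ### Real bi-degrees of the two models. -/

/-- A map `ℝℙ¹ → ℝℙ¹` which is nowhere orthogonal to `u ↦ n u` has degree `n`. -/
theorem hasRealDegree_of_inner_pos {q : Fin 2 → Form} {n : ℤ} {p₀ p₁ : ℝ → ℝ}
    (h₀ : ∀ u, eval ![Real.cos u, Real.sin u] (q 0) = p₀ u)
    (h₁ : ∀ u, eval ![Real.cos u, Real.sin u] (q 1) = p₁ u)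
    (hp₀ : Continuous p₀) (hp₁ : Continuous p₁)
    (hpos : ∀ u, 0 < p₀ u * Real.cos (n * u) + p₁ u * Real.sin (n * u))
    (hinner : ∀ u, p₀ (u + Real.pi) * Real.cos (n * (u + Real.pi)) +
      p₁ (u + Real.pi) * Real.sin (n * (u + Real.pi)) =
      p₀ u * Real.cos (n * u) + p₁ u * Real.sin (n * u))
    (hcross : ∀ u, p₁ (u + Real.pi) * Real.cos (n * (u + Real.pi)) -
      p₀ (u + Real.pi) * Real.sin (n * (u + Real.pi)) =
      p₁ u * Real.cos (n * u) - p₀ u * Real.sin (n * u)) :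
    HasRealDegree q n := by
  -- The lift adds to `n u` the angle from the direction `n u` to the vector `(p₀, p₁)`. Positivity
  -- of the inner product keeps it in `(-π/2, π/2)`, and the last two hypotheses make it
  -- `π`-periodic.
  refine ⟨fun u => n * u + Real.arctan ((p₁ u * Real.cos (n * u) - p₀ u * Real.sin (n * u)) /
    (p₀ u * Real.cos (n * u) + p₁ u * Real.sin (n * u))), ?_, fun u => ?_, fun u => ?_⟩
  · refine Continuous.add (by fun_prop) (Real.continuous_arctan.comp ?_)
    exact Continuous.div (by fun_prop) (by fun_prop) fun u => (hpos u).ne'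
  · rw [h₀, h₁]
    have hD := hpos u
    set D := p₀ u * Real.cos (n * u) + p₁ u * Real.sin (n * u) with hDdef
    set E := p₁ u * Real.cos (n * u) - p₀ u * Real.sin (n * u) with hEdef
    have hs : 0 < √(1 + (E / D) ^ 2) := Real.sqrt_pos.2 (by positivity)
    refine ⟨D * √(1 + (E / D) ^ 2), (mul_pos hD hs).ne', ?_, ?_⟩
    · have e : D * √(1 + (E / D) ^ 2) * Real.cos (n * u + Real.arctan (E / D)) =
          D * Real.cos (n * u) - E * Real.sin (n * u) := by
        rw [Real.cos_add, Real.cos_arctan, Real.sin_arctan]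
        field_simp
      rw [e, hDdef, hEdef]
      linear_combination -p₀ u * Real.sin_sq_add_cos_sq (n * u)
    · have e : D * √(1 + (E / D) ^ 2) * Real.sin (n * u + Real.arctan (E / D)) =
          D * Real.sin (n * u) + E * Real.cos (n * u) := by
        rw [Real.sin_add, Real.cos_arctan, Real.sin_arctan]
        field_simp
      rw [e, hDdef, hEdef]
      linear_combination -p₁ u * Real.sin_sq_add_cos_sq (n * u)
  · simp only [hinner, hcross]
    ring

theorem hasRealDegree_id : HasRealDegree ![X 0, X 1] 1 :=
  ⟨fun u => u, continuous_id, fun u => ⟨1, one_ne_zero, by simp, by simp⟩, fun u => by simp⟩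

theorem X_isHomogeneous (i : Fin 2) :
    ((![X 0, X 1] : Fin 2 → Form) i).IsHomogeneous 1 := by
  fin_cases i
  · exact isHomogeneous_X ℝ 0
  · exact isHomogeneous_X ℝ 1

theorem curveOne_eq : curveOne = twisted ![1, 0, 0, 1] ![1, 0, 0, -1] := by
  ext1 i
  fin_cases i <;> simp [curveOne, twisted, segre, cubic] <;> ring

theorem curveTwo_eq : curveTwo = twisted ![1, 0, -4, 0] ![0, 1, 0, -1] := by
  have h4 : (C 4 : Form) = 4 := map_ofNat C 4
  ext1 i
  fin_cases i <;> simp [curveTwo, twisted, segre, cubic, h4] <;> ring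

theorem hasRealBidegree_twisted {f g : Fin 4 → ℝ} {n : ℤ}
    (h : HasRealDegree ![cubic f, cubic g] n) : HasRealBidegree (twisted f g) 1 n := by
  refine ⟨1, 3, _, _, X_isHomogeneous, fun i => ?_, rfl, hasRealDegree_id, h⟩
  fin_cases i
  · exact cubic_isHomogeneous f
  · exact cubic_isHomogeneous g

theorem hasRealBidegree_curveOne : HasRealBidegree curveOne 1 (-1) := by
  rw [curveOne_eq]
  refine hasRealBidegree_twisted (hasRealDegree_of_inner_pos
    (p₀ := fun u => Real.cos u ^ 3 + Real.sin u ^ 3)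
    (p₁ := fun u => Real.cos u ^ 3 - Real.sin u ^ 3) (fun u => ?_) (fun u => ?_) (by fun_prop)
    (by fun_prop) (fun u => ?_) (fun u => ?_) (fun u => ?_))
  · simp [cubic]
  · simp [cubic]
    ring
  · have h := Real.sin_sq_add_cos_sq u
    simp only [Int.cast_neg, Int.cast_one, neg_one_mul, Real.cos_neg, Real.sin_neg]
    -- With `P = cos² u - sin² u` and `Q = cos u · sin u` the inner product is `P² - PQ + 2Q²`, a
    -- positive definite form, while `P² + 4Q² = 1`.
    nlinarith [sq_nonneg (Real.cos u ^ 2 - Real.sin u ^ 2 - Real.cos u * Real.sin u),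
      sq_nonneg (Real.cos u * Real.sin u), sq_nonneg (Real.cos u ^ 2 - Real.sin u ^ 2)]
  all_goals
    simp only [Int.cast_neg, Int.cast_one, neg_one_mul, Real.cos_neg, Real.sin_neg,
      Real.cos_add_pi, Real.sin_add_pi]
    ring

theorem hasRealBidegree_curveTwo : HasRealBidegree curveTwo 1 3 := by
  rw [curveTwo_eq]
  refine hasRealBidegree_twisted (hasRealDegree_of_inner_pos
    (p₀ := fun u => Real.cos u ^ 3 - 4 * (Real.cos u * Real.sin u ^ 2))
    (p₁ := fun u => Real.cos u ^ 2 * Real.sin u - Real.sin u ^ 3) (fun u => ?_) (fun u => ?_)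
    (by fun_prop) (by fun_prop) (fun u => ?_) (fun u => ?_) (fun u => ?_))
  · simp [cubic]
    ring
  · simp [cubic]
    ring
  · have h := Real.sin_sq_add_cos_sq u
    simp only [Int.cast_ofNat, Real.cos_three_mul, Real.sin_three_mul]
    -- Writing `cos 3u` and `sin 3u` as cubic forms in `cos u`, `sin u` turns the inner product into
    -- a sextic form that is visibly a sum of nonnegative terms.
    have e : (Real.cos u ^ 3 - 4 * (Real.cos u * Real.sin u ^ 2)) *
          (4 * Real.cos u ^ 3 - 3 * Real.cos u) +
        (Real.cos u ^ 2 * Real.sin u - Real.sin u ^ 3) * (3 * Real.sin u - 4 * Real.sin u ^ 3) =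
        Real.cos u ^ 2 * ((Real.cos u ^ 2 - 2 * Real.sin u ^ 2) ^ 2 + 4 * Real.sin u ^ 4) +
          Real.sin u ^ 6 := by
      have hc : Real.cos u ^ 2 = 1 - Real.sin u ^ 2 := by linear_combination h
      have h3 : 4 * Real.cos u ^ 3 - 3 * Real.cos u =
          Real.cos u ^ 3 - 3 * (Real.cos u * Real.sin u ^ 2) := by
        linear_combination 3 * Real.cos u * hc
      have h4 : 3 * Real.sin u - 4 * Real.sin u ^ 3 =
          3 * (Real.cos u ^ 2 * Real.sin u) - Real.sin u ^ 3 := by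
        linear_combination -3 * Real.sin u * hc
      rw [h3, h4]
      ring
    rw [e]
    by_cases hs : Real.sin u = 0
    · have : Real.cos u ^ 2 = 1 := by simpa [hs] using h
      rw [this, hs]
      norm_num
    · positivity
  all_goals
    simp only [Int.cast_ofNat, Real.cos_three_mul, Real.sin_three_mul, Real.cos_add_pi,
      Real.sin_add_pi]
    ring

/-! ### Assembly of the classification. -/

theorem rigidlyIsotopic_of_subset_hyperboloid {C X : Set CP3} (hC : IsRealRationalKnot 4 C)
    (hX : IsHyperboloid X) (h : C ⊆ X) :
    ∃ A ∈ ({1, reflectionMatrix} : Set (GL (Fin 4) ℝ)), ∃ p ∈ standardPairs,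
      RigidlyIsotopic 4 C (projTransform A '' complexPoints (twisted p.1 p.2)) := by
  obtain ⟨k, hk, rfl⟩ := hC
  obtain ⟨B, f, g, hB, hfg, rfl⟩ := exists_eq_transform_twisted_of_subset_hyperboloid hk hX h
  obtain ⟨A, hA, p, hp, hpath⟩ := isStandard_of_noCommonRoot hfg B hB
  rcases hA with rfl | rfl
  · refine ⟨1, by simp, p, hp, ?_⟩
    rw [← complexPoints_transform]
    exact hpath.rigidlyIsotopic
  · refine ⟨reflectionMatrix, by simp, p, hp, ?_⟩
    rw [← complexPoints_transform]
    exact hpath.rigidlyIsotopic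

end RationalKnot

theorem mainTheorem10 :
    (RationalKnot.IsKnotParametrization 4 RationalKnot.curveOne ∧
      RationalKnot.HasRealBidegree RationalKnot.curveOne 1 (-1)) ∧
    (RationalKnot.IsKnotParametrization 4 RationalKnot.curveTwo ∧
      RationalKnot.HasRealBidegree RationalKnot.curveTwo 1 3) ∧
    ∀ C X : Set RationalKnot.CP3,
      RationalKnot.IsRealRationalKnot 4 C → RationalKnot.IsHyperboloid X → C ⊆ X →
        RationalKnot.RigidlyIsotopic 4 C
          (RationalKnot.complexPoints RationalKnot.curveOne) ∨
        RationalKnot.RigidlyIsotopic 4 C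
          (RationalKnot.complexPoints RationalKnot.curveTwo) ∨
        RationalKnot.RigidlyIsotopic 4 C
          (RationalKnot.reflected (RationalKnot.complexPoints RationalKnot.curveOne)) ∨
        RationalKnot.RigidlyIsotopic 4 C
          (RationalKnot.reflected (RationalKnot.complexPoints RationalKnot.curveTwo)) := by
  refine ⟨⟨?_, RationalKnot.hasRealBidegree_curveOne⟩,
    ⟨?_, RationalKnot.hasRealBidegree_curveTwo⟩, fun C X hC hX h => ?_⟩
  · rw [RationalKnot.curveOne_eq]
    exact RationalKnot.isKnotParametrization_twisted RationalKnot.noCommonRoot_standard_one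
  · rw [RationalKnot.curveTwo_eq]
    exact RationalKnot.isKnotParametrization_twisted RationalKnot.noCommonRoot_standard_two
  · rw [RationalKnot.curveOne_eq, RationalKnot.curveTwo_eq]
    have h1 : ∀ S : Set RationalKnot.CP3, RationalKnot.projTransform 1 '' S = S := fun S => by
      simp [funext RationalKnot.projTransform_one_apply, Set.image]
    obtain ⟨A, rfl | rfl, p, rfl | rfl, hiso⟩ :=
      RationalKnot.rigidlyIsotopic_of_subset_hyperboloid hC hX h
    · rw [h1] at hiso
      exact Or.inl hiso
    · rw [h1] at hiso
      exact Or.inr (Or.inl hiso)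
    · exact Or.inr (Or.inr (Or.inl hiso))
    · exact Or.inr (Or.inr (Or.inr hiso))
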